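/- Call a function $U\in L^1([-\pi,\pi])$ (complex-valued, Lebesgue measure) with Fourier coefficients $c_n(U)=\frac1{2\pi}\int_{-\pi}^{\pi}U(x)e^{-inx}\,dx$ asymptotically conditionally universal for $L^1([-\pi,\pi])$ with respect to the trigonometric system $\{e^{inx}\}_{n\in\mathbb Z}$ if there exist signs $\delta_n\in\{1,-1\}$, $n\in\mathbb Z$, and measurable sets $F_1\subset F_2\subset\dots\subset[-\pi,\pi]$ with $\lim_{m\to\infty}|[-\pi,\pi]\setminus F_m|=0$ such that for every $f\in L^1([-\pi,\pi])$ there are natural numbers $N_1<N_2<\dots$ with $$\lim_{q\to\infty}\int_{F_m}\Bigl|\sum_{|n|\le N_q}\delta_n c_n(U)e^{inx}-f(x)\Bigr|\,dx=0\qquad\text{for every }m\in\mathbb N.$$ Define the same notion with respect to the one-sided system $\{e^{inx}\}_{n=1}^\infty$ by taking signs $\delta_n$ for $n\ge1$ only and replacing the partial sums $\sum_{|n|\le N_q}$ by $\sum_{n=1}^{N_q}$. Then there exists a function $U\in L^1([-\pi,\pi])$ that is asymptotically conditionally universal for $L^1([-\pi,\pi])$ with respect to the trigonometric system $\{e^{inx}\}_{n\in\mathbb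 Z}$, and there exists a function $U\in L^1([-\pi,\pi])$ that is asymptotically conditionally universal for $L^1([-\pi,\pi])$ with respect to $\{e^{inx}\}_{n=1}^\infty$. -/

import Mathlib

open MeasureTheory Filter Topology

/-- A minimal system `φ` in (complex) `L¹(μ)`, given together with its biorthogonal system `ψ`
in `L^∞(μ)`: `∫ φ_m ψ_n dμ` is `1` if `m = n` and `0` otherwise. -/
structure BiorthogonalSystem {M : Type*} [MeasurableSpace M] (μ : Measure M) (ι : Type*)
    [DecidableEq ι] where
  /-- the members of the system -/
  φ : ι → M → ℂ
  /-- the densities of the coefficient functionals -/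
  ψ : ι → M → ℂ
  integrable_φ : ∀ n, Integrable (φ n) μ
  memLp_ψ : ∀ n, MemLp (ψ n) ⊤ μ
  biorthogonal : ∀ m n, ∫ x, φ m x * ψ n x ∂μ = if m = n then 1 else 0

namespace BiorthogonalSystem

variable {M : Type*} [MeasurableSpace M] {μ : Measure M} {ι : Type*} [DecidableEq ι]

/-- The Fourier coefficient `c_n(U)` of `U ∈ L¹(μ)` with respect to the system. -/
noncomputable def coeff (S : BiorthogonalSystem μ ι) (n : ι) (U : M → ℂ) : ℂ :=
  ∫ x, U x * S.ψ n x ∂μ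

/-- The subsystem (or rearrangement) picked out by an injective map of the indices. -/
def reindex {κ : Type*} [DecidableEq κ] (S : BiorthogonalSystem μ ι) (j : κ → ι)
    (hj : Function.Injective j) : BiorthogonalSystem μ κ where
  φ k := S.φ (j k)
  ψ k := S.ψ (j k)
  integrable_φ k := S.integrable_φ (j k)
  memLp_ψ k := S.memLp_ψ (j k)
  biorthogonal k l := by
    rw [S.biorthogonal (j k) (j l)]
    by_cases h : k = l
    · simp [h]
    · simp [h, hj.ne h]

/-- `U` is asymptotically conditionally universal for `L¹(μ)` with respect to the system `S`,
with phases in `G`, where the `N`-th partial sum of a series with respect to `S` is the sum over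
the finite index set `A N`: there are phases `δ_n ∈ G` and measurable sets `F_0 ⊆ F_1 ⊆ ...` with
`μ(F_mᶜ) → 0` such that for every `f ∈ L¹(μ)` some subsequence of the partial sums of
`∑ δ_n c_n(U) φ_n` converges to `f` in `L¹(F_m)` for all `m` simultaneously. -/
def IsAsymptoticallyConditionallyUniversal (S : BiorthogonalSystem μ ι) (A : ℕ → Finset ι)
    (G : Set ℂ) (U : M → ℂ) : Prop :=
  ∃ (δ : ι → ℂ) (F : ℕ → Set M),
    (∀ n, δ n ∈ G) ∧
    (∀ m, MeasurableSet (F m)) ∧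
    Monotone F ∧
    Tendsto (fun m => μ (F m)ᶜ) atTop (𝓝 0) ∧
    ∀ f : M → ℂ, Integrable f μ →
      ∃ N : ℕ → ℕ, StrictMono N ∧
        ∀ m, Tendsto
          (fun q => ∫ x in F m, ‖(∑ n ∈ A (N q), δ n * S.coeff n U * S.φ n x) - f x‖ ∂μ)
          atTop (𝓝 0)

end BiorthogonalSystem

/-- Lebesgue measure on `[-π, π]`. -/
noncomputable def volumePi : Measure ℝ := volume.restrict (Set.Icc (-Real.pi) Real.pi)

theorem integral_exp_volumePi (k : ℤ) :
    ∫ x : ℝ, Complex.exp (Complex.I * k * x) ∂volumePi =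
      if k = 0 then (2 * Real.pi : ℂ) else 0 := by
  unfold volumePi
  rw [integral_Icc_eq_integral_Ioc,
    ← intervalIntegral.integral_of_le (by linarith [Real.pi_pos])]
  split_ifs with h
  · subst h
    simp
    ring
  · have hk : Complex.I * (k : ℂ) ≠ 0 :=
      mul_ne_zero Complex.I_ne_zero (by exact_mod_cast h)
    rw [integral_exp_mul_complex hk, div_eq_zero_iff]
    left
    rw [sub_eq_zero, Complex.exp_eq_exp_iff_exists_int]
    exact ⟨k, by push_cast; ring⟩

/-- The trigonometric system `φ_n(x) = e^{inx}`, `n ∈ ℤ`, on `[-π, π]`, with the usual Fourier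
coefficients `c_n(U) = (2π)⁻¹ ∫ U(x) e^{-inx} dx`. -/
noncomputable def trigSystem : BiorthogonalSystem volumePi ℤ where
  φ n x := Complex.exp (Complex.I * n * x)
  ψ n x := (2 * Real.pi : ℂ)⁻¹ * Complex.exp (-(Complex.I * n * x))
  integrable_φ n := by
    unfold volumePi
    exact (Continuous.continuousOn (by fun_prop)).integrableOn_compact isCompact_Icc
  memLp_ψ n := by
    refine memLp_top_of_bound (Continuous.aestronglyMeasurable (by fun_prop))
      ‖(2 * Real.pi : ℂ)⁻¹‖ (Eventually.of_forall fun x => ?_)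
    rw [norm_mul, Complex.norm_exp]
    simp
  biorthogonal m n := by
    have h : ∀ x : ℝ, Complex.exp (Complex.I * m * x) *
        ((2 * Real.pi : ℂ)⁻¹ * Complex.exp (-(Complex.I * n * x))) =
        (2 * Real.pi : ℂ)⁻¹ * Complex.exp (Complex.I * (m - n : ℤ) * x) := by
      intro x
      rw [mul_left_comm, ← Complex.exp_add]
      push_cast
      ring_nf
    simp_rw [h]
    rw [integral_const_mul, integral_exp_volumePi]
    have hpi : (2 * Real.pi : ℂ) ≠ 0 := by simp [Real.pi_ne_zero]
    by_cases hmn : m = n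
    · simp only [hmn, sub_self, if_true]
      exact inv_mul_cancel₀ hpi
    · simp [hmn, sub_eq_zero]

/-- The sequence `e^{ix}, e^{2ix}, e^{3ix}, ...`; the term of index `n : ℕ` is `e^{i(n+1)x}`. -/
noncomputable def trigSequence : BiorthogonalSystem volumePi ℕ :=
  trigSystem.reindex (fun n : ℕ => (n : ℤ) + 1) (fun a b h => by simpa using h)

/-!
A trigonometric polynomial with small `L¹` norm may become large, and prescribed, off a small set
when the signs of some of its coefficients are changed. The precise form is `exists_signChange_near`:
for every integrable `f` there are polynomials `a` and `b` with positive, arbitrarily large frequencies,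
whose coefficients agree up to sign, such that `a` is small in `L¹` and `b` is close to `f` in
`L¹` off a set of small measure. Given this, let `U = ∑ a_k`, where the blocks `a_k` occupy successive
ranges of frequencies and `b_k` corrects `b_0 + ⋯ + b_{k-1}` to approximate the `k`-th term of a sequence
that returns infinitely often to each member of a dense set (`exists_blocks`). As `U` has only positive
frequencies, it serves for both systems.

The proof of `exists_signChange_near` works on the circle and exploits that `u(x)` and `v(s x)` become
independent as `s → ∞` (`tendsto_integral_mul_comp_nsmul`), and that in a product `p(x) K(s x)`
of polynomials with `s` large the signs of the coefficients of `K`, and of those of `p`, can be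
changed independently (`SignChange.dilMul`). There are three ingredients.

* A normalised Fejér kernel `K` has small `L¹` norm but fixed `L²` norm. Choosing the signs of its
  coefficients greedily keeps the fourth moment of the resulting real polynomial `g` bounded by the
  square of the second, and then the mean of `√|1 - g|` is at most a constant below `1`
  (`exists_signChange_integral_sqrt_le`).
* With `1 - H = ∏ (1 - g_i(s_i x))`, for very lacunary `s_i`, the mean of `√|1 - H|` tends to `0`,
  so that `H` is close to `1` off a small set. It arises by a change of signs from
  `G = ∑ K_i(s_i x) ∏_{l < i} (1 - g_l(s_l x))`, which is small in `L¹` if each `K_i` is chosen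
  small in terms of the preceding factors (`exists_signChange_integral_sqrt_lt`).
* A polynomial `h` with only positive frequencies can be close to `1` off a small set: the function
  `1 - exp (2A rz / (1 - rz))` vanishes at `z = 0` and is close to `1` on most of the circle
  (`exists_pos_freq_near_one`).

For a trigonometric polynomial `p` the pair `p(x) G(s₂ x) h(s₁ s₂ x)`, `p(x) H(s₂ x) h(s₁ s₂ x)` is then as
required (`exists_signChange_near_trigPoly`), and trigonometric polynomials are dense in `L¹`.
-/

/-! ### Trigonometric polynomials and sign changes -/

section

variable {T : ℝ}

/-- The trigonometric polynomial `∑ a_k e^{2πikx/T}` on the circle of length `T`, with coefficients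
given by a finitely supported function. -/
noncomputable def trigPoly (T : ℝ) : (ℤ →₀ ℂ) →ₗ[ℂ] C(AddCircle T, ℂ) :=
  Finsupp.linearCombination ℂ (fun n : ℤ => (fourier n : C(AddCircle T, ℂ)))

/-- `b` arises from `a` by changing the signs of some of the coefficients. -/
def SignChange (a b : ℤ →₀ ℂ) : Prop := ∀ k, b k = a k ∨ b k = -a k

/-- The coefficients of the function `p(x) K(s x)`, for trigonometric polynomials `p` and `K`. -/
noncomputable def dilMul (s : ℕ) (p K : ℤ →₀ ℂ) : ℤ →₀ ℂ :=
  K.sum fun j c => p.sum fun k d => Finsupp.single (k + s * j) (d * c)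

theorem trigPoly_apply (a : ℤ →₀ ℂ) (x : AddCircle T) :
    trigPoly T a x = ∑ k ∈ a.support, a k * fourier k x := by
  simp [trigPoly, Finsupp.linearCombination_apply, Finsupp.sum]

theorem trigPoly_single (k : ℤ) (c : ℂ) (x : AddCircle T) :
    trigPoly T (Finsupp.single k c) x = c * fourier k x := by
  simp [trigPoly]

theorem fourier_nsmul (s : ℕ) (j : ℤ) (x : AddCircle T) :
    (fourier j (s • x) : ℂ) = fourier (s * j) x := by
  rw [fourier_apply, fourier_apply, mul_comm, mul_smul, natCast_zsmul]

theorem trigPoly_dilMul (s : ℕ) (p K : ℤ →₀ ℂ) (x : AddCircle T) :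
    trigPoly T (dilMul s p K) x = trigPoly T p x * trigPoly T K (s • x) := by
  rw [dilMul, Finsupp.sum, map_sum, ContinuousMap.coe_sum, Finset.sum_apply,
    trigPoly_apply K, Finset.mul_sum]
  refine Finset.sum_congr rfl fun j _ => ?_
  rw [Finsupp.sum, map_sum, ContinuousMap.coe_sum, Finset.sum_apply, trigPoly_apply p,
    Finset.sum_mul]
  refine Finset.sum_congr rfl fun k _ => ?_
  rw [trigPoly_single, fourier_nsmul, fourier_add]
  ring

theorem dilMul_apply (s : ℕ) (p K : ℤ →₀ ℂ) (m : ℤ) :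
    dilMul s p K m =
      ∑ j ∈ K.support, ∑ k ∈ p.support, if k + s * j = m then p k * K j else 0 := by
  simp only [dilMul, Finsupp.sum, Finsupp.finsetSum_apply]
  exact Finset.sum_congr rfl fun j _ => Finset.sum_congr rfl fun k _ => Finsupp.single_apply

theorem exists_of_dilMul_ne_zero {s : ℕ} {p K : ℤ →₀ ℂ} {m : ℤ} (h : dilMul s p K m ≠ 0) :
    ∃ k j, p k ≠ 0 ∧ K j ≠ 0 ∧ m = k + s * j := by
  rw [dilMul_apply] at h
  obtain ⟨j, hj, h⟩ := Finset.exists_ne_zero_of_sum_ne_zero h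
  obtain ⟨k, hk, h⟩ := Finset.exists_ne_zero_of_sum_ne_zero h
  refine ⟨k, j, Finsupp.mem_support_iff.1 hk, Finsupp.mem_support_iff.1 hj, ?_⟩
  by_contra hm
  exact h (if_neg fun h' => hm h'.symm)

/-- If `s` is large compared with the degree of `p`, the translates of the spectrum of `p` by
multiples of `s` do not overlap, so each coefficient of `p(x) K(s x)` is a single product. -/
theorem dilMul_apply_eq_mul {s : ℕ} {p K : ℤ →₀ ℂ} {d : ℤ} (hp : ∀ k, p k ≠ 0 → |k| ≤ d)
    (hs : 2 * d < s) {k j : ℤ} (hk : |k| ≤ d) : dilMul s p K (k + s * j) = p k * K j := by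
  have key : ∀ k' j', p k' ≠ 0 → k' + s * j' = k + s * j → k' = k ∧ j' = j := by
    intro k' j' hk' h
    have h1 := abs_le.1 (hp k' hk')
    have h2 := abs_le.1 hk
    have hj : j' = j := by
      by_contra hne
      rcases lt_or_gt_of_ne hne with hlt | hlt
      · nlinarith
      · nlinarith
    subst hj
    exact ⟨by linarith, rfl⟩
  rw [dilMul_apply, Finset.sum_eq_single j, Finset.sum_eq_single k]
  · simp
  · intro k' hk' hne
    exact if_neg fun h => hne (key k' j (Finsupp.mem_support_iff.1 hk') h).1
  · intro h
    simp [Finsupp.notMem_support_iff.1 h]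
  · intro j' _ hne
    refine Finset.sum_eq_zero fun k' hk' => if_neg fun h => hne ?_
    exact (key k' j' (Finsupp.mem_support_iff.1 hk') h).2
  · intro h
    simp [Finsupp.notMem_support_iff.1 h]

theorem SignChange.refl (a : ℤ →₀ ℂ) : SignChange a a := fun _ => Or.inl rfl

/-- Sign changes may be carried out independently on polynomials with disjoint spectra. -/
theorem SignChange.add {a b a' b' : ℤ →₀ ℂ} (h : SignChange a b) (h' : SignChange a' b')
    (hd : ∀ k, a k = 0 ∨ a' k = 0) : SignChange (a + a') (b + b') := by
  intro k
  rcases hd k with h0 | h0 <;> rcases h k with h1 | h1 <;> rcases h' k with h2 | h2 <;>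
    simp [h0, h1, h2]

theorem SignChange.eq_zero_iff {a b : ℤ →₀ ℂ} (h : SignChange a b) (k : ℤ) :
    b k = 0 ↔ a k = 0 := by
  rcases h k with h | h <;> simp [h]

theorem SignChange.dilMul {s : ℕ} {p p' K K' : ℤ →₀ ℂ} {d : ℤ} (hpp : SignChange p p')
    (hKK : SignChange K K') (hp : ∀ k, p k ≠ 0 → |k| ≤ d) (hs : 2 * d < s) :
    SignChange (dilMul s p K) (dilMul s p' K') := by
  have hp' : ∀ k, p' k ≠ 0 → |k| ≤ d := fun k hk => hp k fun h => hk ((hpp.eq_zero_iff k).2 h)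
  intro m
  by_cases hm : ∃ k j : ℤ, |k| ≤ d ∧ m = k + s * j
  · obtain ⟨k, j, hk, rfl⟩ := hm
    rw [dilMul_apply_eq_mul hp hs hk, dilMul_apply_eq_mul hp' hs hk]
    rcases hpp k with h | h <;> rcases hKK j with h' | h' <;> simp [h, h']
  · left
    rw [not_imp_comm.1 exists_of_dilMul_ne_zero, not_imp_comm.1 exists_of_dilMul_ne_zero]
    · rintro ⟨k, j, hk, -, rfl⟩
      exact hm ⟨k, j, hp k hk, rfl⟩
    · rintro ⟨k, j, hk, -, rfl⟩
      exact hm ⟨k, j, hp' k hk, rfl⟩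

theorem exists_abs_le_of_ne_zero (p : ℤ →₀ ℂ) : ∃ d : ℕ, ∀ k, p k ≠ 0 → |k| ≤ (d : ℤ) := by
  refine ⟨p.support.sup Int.natAbs, fun k hk => ?_⟩
  rw [Int.abs_eq_natAbs]
  exact_mod_cast Finset.le_sup (f := Int.natAbs) (Finsupp.mem_support_iff.2 hk)

theorem trigPoly_eq_sum_of_subset {a : ℤ →₀ ℂ} {s : Finset ℤ} (h : ∀ k, a k ≠ 0 → k ∈ s)
    (x : AddCircle T) : trigPoly T a x = ∑ k ∈ s, a k * fourier k x := by
  rw [trigPoly_apply]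
  refine Finset.sum_subset (fun k hk => h k (Finsupp.mem_support_iff.1 hk)) fun k _ hk => ?_
  rw [Finsupp.notMem_support_iff.1 hk, zero_mul]

end

/-! ### Dilations of the circle -/

section

variable {T : ℝ} [hT : Fact (0 < T)]

open AddCircle

theorem measurePreserving_nsmul_haarAddCircle {s : ℕ} (hs : s ≠ 0) :
    MeasurePreserving (fun x : AddCircle T => s • x) haarAddCircle haarAddCircle := by
  have := Measure.measurePreserving_zsmul (haarAddCircle (T := T)) (n := (s : ℤ)) (by exact_mod_cast hs)
  simpa using this

theorem ContinuousMap.integrable_haarAddCircle {E : Type*} [NormedAddCommGroup E]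
    (u : C(AddCircle T, E)) : Integrable u haarAddCircle :=
  (BoundedContinuousFunction.mkOfCompact u).continuous.integrable_of_hasCompactSupport
    (HasCompactSupport.of_compactSpace _)

theorem Continuous.integrable_haarAddCircle {E : Type*} [NormedAddCommGroup E]
    {u : AddCircle T → E} (hu : Continuous u) : Integrable u haarAddCircle :=
  hu.integrable_of_hasCompactSupport (HasCompactSupport.of_compactSpace _)

theorem integral_comp_nsmul_haarAddCircle {E : Type*} [NormedAddCommGroup E] [NormedSpace ℝ E]
    {s : ℕ} (hs : s ≠ 0) {u : AddCircle T → E} (hu : Continuous u) :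
    ∫ x : AddCircle T, u (s • x) ∂haarAddCircle = ∫ x, u x ∂haarAddCircle := by
  have h := measurePreserving_nsmul_haarAddCircle (T := T) hs
  conv_rhs => rw [← h.map_eq]
  exact (integral_map h.aemeasurable (h.map_eq.symm ▸ hu.aestronglyMeasurable)).symm

theorem integral_fourier_haarAddCircle (n : ℤ) :
    ∫ x : AddCircle T, (fourier n x : ℂ) ∂haarAddCircle = if n = 0 then 1 else 0 := by
  have := congrFun (fourierCoeff_fourier (T := T) n) 0
  simp only [fourierCoeff, neg_zero, fourier_zero, one_smul] at this
  rw [this]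
  simp [Pi.single_apply, eq_comm]

theorem exists_norm_trigPoly_sub_lt (u : C(AddCircle T, ℂ)) {ε : ℝ} (hε : 0 < ε) :
    ∃ a, ‖trigPoly T a - u‖ < ε := by
  have h : u ∈ (Submodule.span ℂ (Set.range (@fourier T))).topologicalClosure := by
    rw [span_fourier_closure_eq_top]
    trivial
  obtain ⟨v, hv, hvu⟩ := Metric.mem_closure_iff.1 h ε hε
  obtain ⟨a, rfl⟩ := Finsupp.mem_span_range_iff_exists_finsupp.1 hv
  refine ⟨a, ?_⟩
  rw [dist_comm, dist_eq_norm] at hvu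
  exact hvu

/-- For trigonometric polynomials, `u(x)` and `v(s x)` are exactly uncorrelated once `s` exceeds the
degree of `u`. -/
theorem integral_trigPoly_mul_comp_nsmul (a b : ℤ →₀ ℂ) : ∀ᶠ s : ℕ in atTop,
    ∫ x, trigPoly T a x * trigPoly T b (s • x) ∂haarAddCircle =
      (∫ x, trigPoly T a x ∂haarAddCircle) * ∫ x, trigPoly T b x ∂haarAddCircle := by
  have hint : ∀ c : ℤ →₀ ℂ, ∫ x, trigPoly T c x ∂haarAddCircle = c 0 := by
    intro c
    simp_rw [trigPoly_apply]
    rw [integral_finsetSum _ fun k _ =>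
      ((fourier k : C(AddCircle T, ℂ)).integrable_haarAddCircle.const_mul _)]
    simp_rw [integral_const_mul, integral_fourier_haarAddCircle]
    simp [eq_comm]
  obtain ⟨d, hd⟩ := exists_abs_le_of_ne_zero a
  filter_upwards [eventually_gt_atTop (2 * d)] with s hs
  simp_rw [← trigPoly_dilMul, hint]
  have := dilMul_apply_eq_mul (s := s) (K := b) hd (by exact_mod_cast hs) (k := 0) (j := 0)
    (by simp)
  simpa using this

/-- Fejér's lemma: `v(s x)` becomes independent of `u(x)` as `s → ∞`. -/
theorem tendsto_integral_mul_comp_nsmul (u v : C(AddCircle T, ℂ)) :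
    Tendsto (fun s : ℕ => ∫ x, u x * v (s • x) ∂haarAddCircle) atTop
      (𝓝 ((∫ x, u x ∂haarAddCircle) * ∫ x, v x ∂haarAddCircle)) := by
  have hdiff : ∀ (u v u' v' : C(AddCircle T, ℂ)) (s : ℕ),
      ‖∫ x, u x * v (s • x) ∂haarAddCircle - ∫ x, u' x * v' (s • x) ∂haarAddCircle‖ ≤
        ‖u‖ * ‖v - v'‖ + ‖u - u'‖ * ‖v'‖ := by
    intro u v u' v' s
    have hc : ∀ w w' : C(AddCircle T, ℂ),
        Integrable (fun x : AddCircle T => w x * w' (s • x)) haarAddCircle := fun w w' =>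
      Continuous.integrable_haarAddCircle (by fun_prop)
    rw [← integral_sub (hc u v) (hc u' v')]
    refine (norm_integral_le_of_norm_le_const (C := ‖u‖ * ‖v - v'‖ + ‖u - u'‖ * ‖v'‖)
      (Eventually.of_forall fun x => ?_)).trans (by simp)
    have : u x * v (s • x) - u' x * v' (s • x) =
        u x * (v - v') (s • x) + (u - u') x * v' (s • x) := by
      simp
      ring
    rw [this]
    refine (norm_add_le _ _).trans ?_
    rw [norm_mul, norm_mul]
    gcongr <;> exact ContinuousMap.norm_coe_le_norm _ _
  have hdiff' : ∀ (u v u' v' : C(AddCircle T, ℂ)),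
      ‖(∫ x, u x ∂haarAddCircle) * ∫ x, v x ∂haarAddCircle -
        (∫ x, u' x ∂haarAddCircle) * ∫ x, v' x ∂haarAddCircle‖ ≤
        ‖u‖ * ‖v - v'‖ + ‖u - u'‖ * ‖v'‖ := by
    intro u v u' v'
    have hn : ∀ w : C(AddCircle T, ℂ), ‖∫ x, w x ∂haarAddCircle‖ ≤ ‖w‖ := fun w =>
      (norm_integral_le_of_norm_le_const (Eventually.of_forall fun x =>
        ContinuousMap.norm_coe_le_norm w x)).trans (by simp)
    have hs : ∀ w w' : C(AddCircle T, ℂ), ∫ x, w x ∂haarAddCircle - ∫ x, w' x ∂haarAddCircle =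
        ∫ x, (w - w') x ∂haarAddCircle := fun w w' =>
      (integral_sub w.integrable_haarAddCircle w'.integrable_haarAddCircle).symm
    have : (∫ x, u x ∂haarAddCircle) * ∫ x, v x ∂haarAddCircle -
        (∫ x, u' x ∂haarAddCircle) * ∫ x, v' x ∂haarAddCircle =
        (∫ x, u x ∂haarAddCircle) * ∫ x, (v - v') x ∂haarAddCircle +
        (∫ x, (u - u') x ∂haarAddCircle) * ∫ x, v' x ∂haarAddCircle := by
      rw [← hs, ← hs]
      ring
    rw [this]
    refine (norm_add_le _ _).trans ?_
    rw [norm_mul, norm_mul]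
    gcongr <;> exact hn _
  rw [Metric.tendsto_nhds]
  intro ε hε
  obtain ⟨b, hb⟩ := exists_norm_trigPoly_sub_lt v (ε := ε / 4 / (‖u‖ + 1)) (by positivity)
  obtain ⟨a, ha⟩ := exists_norm_trigPoly_sub_lt u (ε := ε / 4 / (‖trigPoly T b‖ + 1))
    (by positivity)
  have hsmall : ‖u‖ * ‖v - trigPoly T b‖ + ‖u - trigPoly T a‖ * ‖trigPoly T b‖ < ε / 2 := by
    rw [norm_sub_rev, lt_div_iff₀ (by positivity)] at ha hb
    have h1 := norm_nonneg (v - trigPoly T b)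
    have h2 := norm_nonneg (u - trigPoly T a)
    nlinarith
  filter_upwards [integral_trigPoly_mul_comp_nsmul (T := T) a b] with s hs
  have h1 := hdiff u v (trigPoly T a) (trigPoly T b) s
  have h2 := hdiff' u v (trigPoly T a) (trigPoly T b)
  rw [hs] at h1
  rw [← dist_eq_norm] at h1 h2
  rw [dist_comm] at h2
  linarith [dist_triangle (∫ x, u x * v (s • x) ∂haarAddCircle)
    ((∫ x, trigPoly T a x ∂haarAddCircle) * ∫ x, trigPoly T b x ∂haarAddCircle)
    ((∫ x, u x ∂haarAddCircle) * ∫ x, v x ∂haarAddCircle)]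

theorem tendsto_integral_mul_comp_nsmul_real {u v : AddCircle T → ℝ} (hu : Continuous u)
    (hv : Continuous v) :
    Tendsto (fun s : ℕ => ∫ x, u x * v (s • x) ∂haarAddCircle) atTop
      (𝓝 ((∫ x, u x ∂haarAddCircle) * ∫ x, v x ∂haarAddCircle)) := by
  have h := tendsto_integral_mul_comp_nsmul (T := T)
    ⟨fun x => (u x : ℂ), by fun_prop⟩ ⟨fun x => (v x : ℂ), by fun_prop⟩
  simp only [ContinuousMap.coe_mk, ← Complex.ofReal_mul, integral_complex_ofReal] at h
  exact_mod_cast (Complex.continuous_re.tendsto _).comp h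

end

/-! ### Cosine polynomials with prescribed sizes of coefficients -/

section

open AddCircle

/-- The function `cos (2πkx/T)` on the circle of length `T`. -/
noncomputable def fourierCos {T : ℝ} (k : ℤ) (x : AddCircle T) : ℝ := (fourier k x : ℂ).re

variable {T : ℝ}

@[fun_prop]
theorem continuous_fourierCos (k : ℤ) : Continuous (fourierCos k : AddCircle T → ℝ) :=
  Complex.continuous_re.comp (fourier k).continuous

theorem norm_fourier_apply (k : ℤ) (x : AddCircle T) : ‖(fourier k x : ℂ)‖ = 1 := by
  rw [fourier_apply]
  exact Circle.norm_coe _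

theorem abs_fourierCos_le_one (k : ℤ) (x : AddCircle T) : |fourierCos k x| ≤ 1 :=
  (Complex.abs_re_le_norm _).trans (norm_fourier_apply k x).le

theorem fourierCos_mul_fourierCos (k l : ℤ) (x : AddCircle T) :
    fourierCos k x * fourierCos l x = (fourierCos (k + l) x + fourierCos (k - l) x) / 2 := by
  simp only [fourierCos, sub_eq_add_neg, fourier_add, fourier_neg, Complex.mul_re,
    Complex.conj_re, Complex.conj_im]
  ring

theorem ofReal_fourierCos (k : ℤ) (x : AddCircle T) :
    (fourierCos k x : ℂ) = (fourier k x + fourier (-k) x) / 2 := by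
  rw [fourier_neg, Complex.add_conj, fourierCos]
  push_cast
  ring

/-- The squared modulus of the geometric sum is `N` times the Fejér kernel, which exhibits the Fejér
kernel as a nonnegative cosine polynomial. -/
theorem normSq_sum_fourier (N : ℕ) (x : AddCircle T) :
    Complex.normSq (∑ j ∈ Finset.range N, (fourier (j : ℤ) x : ℂ)) =
      N + 2 * ∑ k ∈ Finset.range N, ((N : ℝ) - (k + 1)) * fourierCos (k + 1) x := by
  induction N with
  | zero => simp
  | succ N ih =>
    have hone : Complex.normSq (fourier (N : ℤ) x : ℂ) = 1 := by
      rw [Complex.normSq_eq_norm_sq, norm_fourier_apply, one_pow]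
    have hre : ((∑ j ∈ Finset.range N, (fourier (j : ℤ) x : ℂ)) *
        (starRingEnd ℂ) (fourier (N : ℤ) x)).re =
        ∑ k ∈ Finset.range N, fourierCos ((k : ℤ) + 1) x := by
      rw [← Finset.sum_range_reflect, Finset.sum_mul, Complex.re_sum]
      refine Finset.sum_congr rfl fun j hj => ?_
      have hj' := Finset.mem_range.1 hj
      rw [← fourier_neg, ← fourier_add, fourierCos, ← Complex.conj_re, ← fourier_neg]
      congr 3
      omega
    rw [Finset.sum_range_succ, Complex.normSq_add, ih, hone, hre, Finset.sum_range_succ]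
    have : ∑ k ∈ Finset.range N, (((N + 1 : ℕ) : ℝ) - (k + 1)) * fourierCos ((k : ℤ) + 1) x =
        ∑ k ∈ Finset.range N, ((N : ℝ) - (k + 1)) * fourierCos ((k : ℤ) + 1) x +
          ∑ k ∈ Finset.range N, fourierCos ((k : ℤ) + 1) x := by
      rw [← Finset.sum_add_distrib]
      refine Finset.sum_congr rfl fun k _ => ?_
      push_cast
      ring
    rw [this]
    push_cast
    ring

/-- The coefficients of the cosine polynomial `∑_{k < n} c_k cos (2π(k+1)x/T)`. -/
noncomputable def cosPoly (c : ℕ → ℝ) (n : ℕ) : ℤ →₀ ℂ :=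
  ∑ k ∈ Finset.range n,
    (Finsupp.single ((k : ℤ) + 1) (c k / 2 : ℂ) + Finsupp.single (-((k : ℤ) + 1)) (c k / 2 : ℂ))

theorem trigPoly_cosPoly (c : ℕ → ℝ) (n : ℕ) (x : AddCircle T) :
    trigPoly T (cosPoly c n) x =
      ((∑ k ∈ Finset.range n, c k * fourierCos (k + 1) x : ℝ) : ℂ) := by
  rw [cosPoly, map_sum, ContinuousMap.coe_sum, Finset.sum_apply, Complex.ofReal_sum]
  refine Finset.sum_congr rfl fun k _ => ?_
  rw [map_add, ContinuousMap.add_apply, trigPoly_single, trigPoly_single, Complex.ofReal_mul,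
    ofReal_fourierCos]
  ring

theorem cosPoly_apply (c : ℕ → ℝ) (n : ℕ) (m : ℤ) :
    cosPoly c n m = if m ≠ 0 ∧ m.natAbs ≤ n then (c (m.natAbs - 1) / 2 : ℂ) else 0 := by
  have hz : ∀ k : ℕ, k + 1 ≠ m.natAbs →
      (Finsupp.single ((k : ℤ) + 1) (c k / 2 : ℂ) +
        Finsupp.single (-((k : ℤ) + 1)) (c k / 2 : ℂ)) m = 0 := by
    intro k hk
    rw [Finsupp.add_apply, Finsupp.single_apply, Finsupp.single_apply, if_neg (by omega),
      if_neg (by omega), add_zero]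
  rw [cosPoly, Finsupp.finsetSum_apply]
  split_ifs with h
  · rw [Finset.sum_eq_single (m.natAbs - 1)]
    · rw [Finsupp.add_apply, Finsupp.single_apply, Finsupp.single_apply]
      rcases lt_or_gt_of_ne h.1 with hm | hm
      · rw [if_neg (by omega), if_pos (by omega), zero_add]
      · rw [if_pos (by omega), if_neg (by omega), add_zero]
    · intro k _ hk
      exact hz k (by omega)
    · intro hk
      rw [Finset.mem_range] at hk
      omega
  · refine Finset.sum_eq_zero fun k hk => hz k ?_
    rw [Finset.mem_range] at hk
    omega

theorem signChange_cosPoly (c : ℕ → ℝ) {ε : ℕ → ℝ} (hε : ∀ k, ε k = 1 ∨ ε k = -1) (n : ℕ) :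
    SignChange (cosPoly c n) (cosPoly (fun k => ε k * c k) n) := by
  intro m
  rw [cosPoly_apply, cosPoly_apply]
  split_ifs with h
  · rcases hε (m.natAbs - 1) with h | h
    · left
      simp [h]
    · right
      simp [h]
      ring
  · simp

variable [hT : Fact (0 < T)]

theorem integral_fourierCos (k : ℤ) :
    ∫ x : AddCircle T, fourierCos k x ∂haarAddCircle = if k = 0 then 1 else 0 := by
  have h := integral_re (𝕜 := ℂ) (fourier k : C(AddCircle T, ℂ)).integrable_haarAddCircle
  simp only [RCLike.re_eq_complex_re] at h
  simp only [fourierCos]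
  rw [h, integral_fourier_haarAddCircle]
  split_ifs <;> simp

theorem integral_sum_fourierCos (c : ℕ → ℝ) (n : ℕ) :
    ∫ x : AddCircle T, ∑ k ∈ Finset.range n, c k * fourierCos (k + 1) x ∂haarAddCircle = 0 := by
  rw [integral_finsetSum _ fun k _ => Continuous.integrable_haarAddCircle (by fun_prop)]
  refine Finset.sum_eq_zero fun k _ => ?_
  rw [integral_const_mul, integral_fourierCos, if_neg (by omega), mul_zero]

theorem integral_sum_fourierCos_sq (c : ℕ → ℝ) (n : ℕ) :
    ∫ x : AddCircle T, (∑ k ∈ Finset.range n, c k * fourierCos (k + 1) x) ^ 2 ∂haarAddCircle =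
      (∑ k ∈ Finset.range n, c k ^ 2) / 2 := by
  simp_rw [sq, Finset.sum_mul_sum]
  rw [integral_finsetSum _ fun k _ => Continuous.integrable_haarAddCircle (by fun_prop),
    Finset.sum_div]
  refine Finset.sum_congr rfl fun k hk => ?_
  rw [integral_finsetSum _ fun l _ => Continuous.integrable_haarAddCircle (by fun_prop)]
  have : ∀ l : ℕ, ∫ x : AddCircle T, c k * fourierCos (k + 1) x * (c l * fourierCos (l + 1) x)
      ∂haarAddCircle = if k = l then c k * c l / 2 else 0 := by
    intro l
    have h1 : ∀ x : AddCircle T, c k * fourierCos (k + 1) x * (c l * fourierCos (l + 1) x) =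
        c k * c l / 2 * (fourierCos (k + 1 + (l + 1)) x + fourierCos (k + 1 - (l + 1)) x) := by
      intro x
      have := fourierCos_mul_fourierCos (k + 1) (l + 1) x
      linear_combination c k * c l * this
    simp_rw [h1]
    rw [integral_const_mul, integral_add (Continuous.integrable_haarAddCircle (by fun_prop))
      (Continuous.integrable_haarAddCircle (by fun_prop)), integral_fourierCos,
      integral_fourierCos, if_neg (by omega)]
    by_cases hkl : k = l
    · simp [hkl]
    · rw [if_neg (by omega), if_neg hkl]
      simp
  simp_rw [this]
  rw [Finset.sum_ite_eq, if_pos hk]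

/-- The signs are chosen one at a time: averaging the fourth moment over the two choices of the next
sign shows that one of them keeps the bound, as for a sum of independent random signs. -/
theorem exists_signs_integral_pow_four_le (T : ℝ) [Fact (0 < T)] (c : ℕ → ℝ) (n : ℕ) :
    ∃ ε : ℕ → ℝ, (∀ k, ε k = 1 ∨ ε k = -1) ∧
      ∫ x : AddCircle T, (∑ k ∈ Finset.range n, ε k * c k * fourierCos (k + 1) x) ^ 4
        ∂haarAddCircle ≤ 3 * (∑ k ∈ Finset.range n, c k ^ 2) ^ 2 := by
  induction n with
  | zero => exact ⟨fun _ => 1, fun _ => Or.inl rfl, by simp⟩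
  | succ n ih =>
    obtain ⟨ε, hε, hY⟩ := ih
    set Y : AddCircle T → ℝ := fun x => ∑ k ∈ Finset.range n, ε k * c k * fourierCos (k + 1) x
      with hYdef
    set S := ∑ k ∈ Finset.range n, c k ^ 2 with hS
    have hYc : Continuous Y := by fun_prop
    have hS0 : 0 ≤ S := Finset.sum_nonneg fun k _ => sq_nonneg _
    have hY2 : ∫ x, Y x ^ 2 ∂haarAddCircle = S / 2 := by
      rw [hYdef, integral_sum_fourierCos_sq, hS]
      congr 1
      refine Finset.sum_congr rfl fun k _ => ?_
      rcases hε k with h | h <;> simp [h]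
    let w : AddCircle T → ℝ := fourierCos ((n : ℤ) + 1)
    have hwc : Continuous w := continuous_fourierCos _
    have hw : ∀ x, w x ^ 2 ≤ 1 := fun x => by
      rw [sq_le_one_iff_abs_le_one]
      exact abs_fourierCos_le_one _ _
    let Z : ℝ → AddCircle T → ℝ := fun e x => Y x + e * c n * w x
    have hZc : ∀ e, Continuous (Z e) := fun e => by fun_prop
    have havg : ∫ x, Z 1 x ^ 4 ∂haarAddCircle + ∫ x, Z (-1) x ^ 4 ∂haarAddCircle ≤
        2 * (3 * (S + c n ^ 2) ^ 2) := by
      have hle : ∫ x, (Z 1 x ^ 4 + Z (-1) x ^ 4) ∂haarAddCircle ≤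
          ∫ x, (2 * Y x ^ 4 + 12 * c n ^ 2 * Y x ^ 2 + 2 * c n ^ 4) ∂haarAddCircle := by
        refine integral_mono (Continuous.integrable_haarAddCircle (by fun_prop))
          (Continuous.integrable_haarAddCircle (by fun_prop)) fun x => ?_
        have h1 := mul_le_mul_of_nonneg_left (hw x) (mul_nonneg (sq_nonneg (c n)) (sq_nonneg (Y x)))
        have h2 : w x ^ 4 ≤ 1 := by nlinarith [hw x, sq_nonneg (w x)]
        have h3 := mul_le_mul_of_nonneg_left h2 (by positivity : 0 ≤ c n ^ 4)
        simp only [Z]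
        nlinarith
      rw [integral_add (Continuous.integrable_haarAddCircle (by fun_prop))
        (Continuous.integrable_haarAddCircle (by fun_prop)),
        integral_add (Continuous.integrable_haarAddCircle (by fun_prop))
        (Continuous.integrable_haarAddCircle (by fun_prop)),
        integral_add (Continuous.integrable_haarAddCircle (by fun_prop))
        (Continuous.integrable_haarAddCircle (by fun_prop)), integral_const_mul,
        integral_const_mul, hY2] at hle
      simp only [integral_const, probReal_univ, one_smul] at hle
      nlinarith [sq_nonneg (c n), mul_nonneg hS0 (sq_nonneg (c n)), sq_nonneg (c n ^ 2)]
    obtain ⟨e, he, hle⟩ : ∃ e : ℝ, (e = 1 ∨ e = -1) ∧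
        ∫ x, Z e x ^ 4 ∂haarAddCircle ≤ 3 * (S + c n ^ 2) ^ 2 := by
      by_contra! hcon
      linarith [hcon 1 (Or.inl rfl), hcon (-1) (Or.inr rfl)]
    refine ⟨Function.update ε n e, fun k => ?_, ?_⟩
    · by_cases hk : k = n
      · simpa [hk] using he
      · simpa [hk] using hε k
    · rw [Finset.sum_range_succ, ← hS]
      convert hle using 4 with x
      rw [Finset.sum_range_succ, Function.update_self]
      simp only [Z, Y, w]
      congr 1
      refine Finset.sum_congr rfl fun k hk => ?_
      rw [Function.update_of_ne (Finset.mem_range.1 hk).ne]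

/-- The Taylor expansion of `√(1 - y)` to second order, turned into a bound valid for all `y` by a
fourth-order term and a worse constant at `y²`. -/
theorem sqrt_abs_one_sub_le (y : ℝ) : √|1 - y| ≤ 1 - y / 2 - y ^ 2 / 16 + y ^ 4 := by
  set t := √|1 - y|
  have ht0 : 0 ≤ t := Real.sqrt_nonneg _
  have hsq : t ^ 2 = |1 - y| := Real.sq_sqrt (abs_nonneg _)
  clear_value t
  rcases le_total y 1 with h | h
  · rw [abs_of_nonneg (by linarith)] at hsq
    obtain rfl : y = 1 - t ^ 2 := by linarith
    have hfac : 1 - (1 - t ^ 2) / 2 - (1 - t ^ 2) ^ 2 / 16 + (1 - t ^ 2) ^ 4 - t =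
        (1 - t) ^ 2 * (1 / 2 - (1 + t) ^ 2 / 16 + (1 - t) ^ 2 * (1 + t) ^ 4) := by ring
    have hpos : 0 ≤ 1 / 2 - (1 + t) ^ 2 / 16 + (1 - t) ^ 2 * (1 + t) ^ 4 := by
      rcases le_total t (9 / 5) with h' | h'
      · have : 0 ≤ (1 - t) ^ 2 * (1 + t) ^ 4 := by positivity
        nlinarith
      · have h1 : 16 / 25 ≤ (1 - t) ^ 2 := by nlinarith
        have h2 : 1 ≤ (1 + t) ^ 2 := by nlinarith
        have h3 : (1 + t) ^ 2 ≤ (1 + t) ^ 4 := by nlinarith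
        have h4 : 0 ≤ (1 + t) ^ 4 := by positivity
        nlinarith
    have := mul_nonneg (sq_nonneg (1 - t)) hpos
    linarith
  · rw [abs_of_nonpos (by linarith)] at hsq
    obtain rfl : y = 1 + t ^ 2 := by linarith
    set w := 1 + t ^ 2 with hw
    have h1 : t ≤ w / 2 := by nlinarith [sq_nonneg (1 - t)]
    have h2 : w ^ 2 ≤ w ^ 4 := pow_le_pow_right₀ h (by norm_num)
    nlinarith

/-- A normalised Fejér kernel (without its mean) has small `L¹` norm but fixed `L²` norm. Some change
of signs of its coefficients is spread out so evenly that its fourth moment is controlled by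
its second one; then `√|1 - g|` has mean strictly below `1`, by strict concavity. -/
theorem exists_signChange_integral_sqrt_le (T : ℝ) [Fact (0 < T)] {η : ℝ} (hη : 0 < η) :
    ∃ K g : ℤ →₀ ℂ, SignChange K g ∧ K 0 = 0 ∧
      ∫ x, ‖trigPoly T K x‖ ∂haarAddCircle < η ∧
      ∫ x, √‖1 - trigPoly T g x‖ ∂haarAddCircle ≤ 1 - 1 / 12288 := by
  obtain ⟨N, hN⟩ := exists_nat_gt (2 + 1 / (16 * η ^ 2))
  have hN2 : (2 : ℝ) < N := by
    have : 0 < 1 / (16 * η ^ 2) := by positivity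
    linarith
  set Q : ℝ := ∑ k ∈ Finset.range N, ((N : ℝ) - (k + 1)) ^ 2 with hQ
  have hQN : (N : ℝ) ^ 3 / 12 ≤ Q := by
    have h1 : Q = ∑ k ∈ Finset.range N, (k : ℝ) ^ 2 := by
      rw [hQ, ← Finset.sum_range_reflect]
      refine Finset.sum_congr rfl fun k hk => ?_
      have hk' := Finset.mem_range.1 hk
      rw [Nat.sub_sub, Nat.cast_sub (by omega)]
      push_cast
      ring
    have h2 : ∀ n : ℕ, ∑ k ∈ Finset.range n, (k : ℝ) ^ 2 = (n - 1) * n * (2 * n - 1) / 6 := by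
      intro n
      induction n with
      | zero => simp
      | succ n ih =>
        rw [Finset.sum_range_succ, ih]
        push_cast
        ring
    rw [h1, h2]
    have h3 : (N : ℝ) / 2 ≤ N - 1 := by linarith
    have h4 : (N : ℝ) ≤ 2 * N - 1 := by linarith
    have h6 : 0 ≤ ((N : ℝ) - 1) * N := mul_nonneg (by linarith) (by linarith)
    have h5 : (N : ℝ) / 2 * N * N ≤ (N - 1) * N * (2 * N - 1) := by gcongr
    nlinarith
  have hQ0 : 0 < Q := lt_of_lt_of_le (by positivity) hQN
  -- With this normalisation the sum of the squares of the cosine coefficients is `1 / 192`.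
  set r : ℝ := 1 / √(192 * Q) with hr
  have hr0 : 0 < r := by positivity
  have hrQ : r ^ 2 * Q = 1 / 192 := by
    rw [hr, div_pow, Real.sq_sqrt (by positivity)]
    field_simp
  set c : ℕ → ℝ := fun k => r * ((N : ℝ) - (k + 1)) with hc
  have hS : ∑ k ∈ Finset.range N, c k ^ 2 = 1 / 192 := by
    rw [← hrQ, hQ, Finset.mul_sum]
    exact Finset.sum_congr rfl fun k _ => by simp only [hc]; ring
  obtain ⟨ε, hε, h4⟩ := exists_signs_integral_pow_four_le T c N
  refine ⟨cosPoly c N, cosPoly (fun k => ε k * c k) N, signChange_cosPoly c hε N, ?_, ?_, ?_⟩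
  · simp [cosPoly_apply]
  · have hD : ∀ x : AddCircle T, ‖trigPoly T (cosPoly c N) x‖ ≤ r * N +
        ∑ k ∈ Finset.range N, c k * fourierCos (k + 1) x := by
      intro x
      have h := normSq_sum_fourier N x
      have h0 := Complex.normSq_nonneg (∑ j ∈ Finset.range N, (fourier (j : ℤ) x : ℂ))
      have hsum : ∑ k ∈ Finset.range N, c k * fourierCos (k + 1) x =
          r * ∑ k ∈ Finset.range N, ((N : ℝ) - (k + 1)) * fourierCos (k + 1) x := by
        rw [Finset.mul_sum]
        exact Finset.sum_congr rfl fun k _ => by simp only [hc]; ring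
      rw [trigPoly_cosPoly, Complex.norm_real, Real.norm_eq_abs, hsum, abs_le]
      have h1 := mul_nonneg hr0.le (h.symm ▸ h0)
      constructor <;> nlinarith
    calc ∫ x, ‖trigPoly T (cosPoly c N) x‖ ∂haarAddCircle
        ≤ ∫ x : AddCircle T, (r * N + ∑ k ∈ Finset.range N, c k * fourierCos (k + 1) x)
            ∂haarAddCircle :=
          integral_mono (Continuous.integrable_haarAddCircle (by fun_prop))
            (Continuous.integrable_haarAddCircle (by fun_prop)) hD
      _ = r * N := by
          rw [integral_add (Continuous.integrable_haarAddCircle (by fun_prop))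
            (Continuous.integrable_haarAddCircle (by fun_prop)), integral_sum_fourierCos]
          simp
      _ < η := by
          have h1 : (r * N) ^ 2 < η ^ 2 := by
            have h2 : 1 / (16 * η ^ 2) < N := by linarith
            rw [div_lt_iff₀ (by positivity)] at h2
            have h3 : r ^ 2 * ((N : ℝ) ^ 3 / 12) ≤ 1 / 192 := by
              rw [← hrQ]
              gcongr
            have h4 : r ^ 2 * (N : ℝ) ^ 3 ≤ 1 / 16 := by linarith
            have h5 : (r * N) ^ 2 * N < η ^ 2 * N := by nlinarith
            exact lt_of_mul_lt_mul_right h5 (by positivity)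
          exact lt_of_pow_lt_pow_left₀ 2 hη.le h1
  · set Y : AddCircle T → ℝ := fun x =>
      ∑ k ∈ Finset.range N, ε k * c k * fourierCos (k + 1) x with hY
    have hYc : Continuous Y := by fun_prop
    have h1 : ∫ x, Y x ∂haarAddCircle = 0 := integral_sum_fourierCos _ N
    have h2 : ∫ x, Y x ^ 2 ∂haarAddCircle = 1 / 384 := by
      rw [hY, integral_sum_fourierCos_sq]
      have : ∑ k ∈ Finset.range N, (ε k * c k) ^ 2 = 1 / 192 := by
        rw [← hS]
        refine Finset.sum_congr rfl fun k _ => ?_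
        rcases hε k with h | h <;> simp [h]
      rw [this]
      norm_num
    rw [hS] at h4
    calc ∫ x, √‖1 - trigPoly T (cosPoly (fun k => ε k * c k) N) x‖ ∂haarAddCircle
        ≤ ∫ x, (1 - Y x / 2 - Y x ^ 2 / 16 + Y x ^ 4) ∂haarAddCircle := by
          refine integral_mono (Continuous.integrable_haarAddCircle (by fun_prop))
            (Continuous.integrable_haarAddCircle (by fun_prop)) fun x => ?_
          simp only [trigPoly_cosPoly]
          rw [← Complex.ofReal_one, ← Complex.ofReal_sub, Complex.norm_real]
          exact sqrt_abs_one_sub_le _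
      _ = 1 - 0 / 2 - 1 / 384 / 16 + ∫ x, Y x ^ 4 ∂haarAddCircle := by
          rw [integral_add (Continuous.integrable_haarAddCircle (by fun_prop))
            (Continuous.integrable_haarAddCircle (by fun_prop)),
            integral_sub (Continuous.integrable_haarAddCircle (by fun_prop))
            (Continuous.integrable_haarAddCircle (by fun_prop)),
            integral_sub (Continuous.integrable_haarAddCircle (by fun_prop))
            (Continuous.integrable_haarAddCircle (by fun_prop)), integral_div, integral_div,
            h1, h2]
          simp
      _ ≤ 1 - 0 / 2 - 1 / 384 / 16 + 3 * (1 / 192) ^ 2 := by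
          gcongr
      _ = 1 - 1 / 12288 := by norm_num

end

/-! ### Small polynomials that a sign change brings close to a constant -/

section

open AddCircle

/-- Multiplying `1 - H` repeatedly by independent copies `1 - g(s x)` makes `∫ √|1 - H|` decay
geometrically, while the term that each step adds to `G` can be made as small in `L¹` as desired. -/
theorem exists_signChange_integral_sqrt_lt (T : ℝ) [Fact (0 < T)] {η : ℝ} (hη : 0 < η) :
    ∃ G H : ℤ →₀ ℂ, SignChange G H ∧ ∫ x, ‖trigPoly T G x‖ ∂haarAddCircle < η ∧
      ∫ x, √‖1 - trigPoly T H x‖ ∂haarAddCircle < η := by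
  have key : ∀ (n : ℕ) (η : ℝ), 0 < η → ∃ G H : ℤ →₀ ℂ, SignChange G H ∧
      ∫ x, ‖trigPoly T G x‖ ∂haarAddCircle < η ∧
      ∫ x, √‖1 - trigPoly T H x‖ ∂haarAddCircle ≤ (1 - 1 / 24576 : ℝ) ^ n := by
    intro n
    induction n with
    | zero =>
      intro η hη
      exact ⟨0, 0, SignChange.refl 0, by simpa using hη, by simp⟩
    | succ n ih =>
      intro η hη
      obtain ⟨G, H, hGH, hG, hH⟩ := ih (η / 2) (by positivity)
      set P : ℤ →₀ ℂ := Finsupp.single 0 1 - H with hP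
      have hPx : ∀ x, trigPoly T P x = 1 - trigPoly T H x := fun x => by
        rw [hP, map_sub, ContinuousMap.sub_apply, trigPoly_single, fourier_zero, mul_one]
      -- `K` is chosen after `H`, so the supremum of `1 - H` need not be controlled.
      obtain ⟨K, g, hKg, hK0, hK, hg⟩ := exists_signChange_integral_sqrt_le T
        (η := η / 2 / (‖trigPoly T P‖ + 1)) (by positivity)
      obtain ⟨d₁, hd₁⟩ := exists_abs_le_of_ne_zero G
      obtain ⟨d₂, hd₂⟩ := exists_abs_le_of_ne_zero P
      set d : ℤ := max d₁ d₂ with hd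
      have hPd : ∀ k, P k ≠ 0 → |k| ≤ d := fun k hk => (hd₂ k hk).trans (le_max_right _ _)
      have hlim := tendsto_integral_mul_comp_nsmul_real (T := T)
        (u := fun x => √‖1 - trigPoly T H x‖) (v := fun x => √‖1 - trigPoly T g x‖)
        (by fun_prop) (by fun_prop)
      have hlt : (∫ x, √‖1 - trigPoly T H x‖ ∂haarAddCircle) *
          ∫ x, √‖1 - trigPoly T g x‖ ∂haarAddCircle < (1 - 1 / 24576 : ℝ) ^ (n + 1) :=
        calc _ ≤ (1 - 1 / 24576 : ℝ) ^ n * (1 - 1 / 12288) := by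
              gcongr
          _ < (1 - 1 / 24576 : ℝ) ^ n * (1 - 1 / 24576) := by
              gcongr
              norm_num
          _ = _ := (pow_succ _ _).symm
      obtain ⟨s, hs, hsd, hs0⟩ := ((hlim.eventually_lt_const hlt).and
        (((tendsto_natCast_atTop_atTop (R := ℤ)).eventually_gt_atTop (2 * d)).and
          (eventually_ne_atTop 0))).exists
      refine ⟨G + dilMul s P K, H + dilMul s P g,
        hGH.add ((SignChange.refl P).dilMul hKg hPd hsd) fun k => ?_, ?_, ?_⟩
      · by_cases hk : G k = 0
        · exact Or.inl hk
        · right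
          have := dilMul_apply_eq_mul (K := K) hPd hsd (k := k) (j := 0)
            ((hd₁ k hk).trans (le_max_left _ _))
          simpa [hK0] using this
      · calc ∫ x, ‖trigPoly T (G + dilMul s P K) x‖ ∂haarAddCircle
            ≤ ∫ x, (‖trigPoly T G x‖ + ‖trigPoly T P‖ * ‖trigPoly T K (s • x)‖)
                ∂haarAddCircle := by
              refine integral_mono (Continuous.integrable_haarAddCircle (by fun_prop))
                (Continuous.integrable_haarAddCircle (by fun_prop)) fun x => ?_
              simp only [map_add, ContinuousMap.add_apply, trigPoly_dilMul]
              refine (norm_add_le _ _).trans ?_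
              rw [norm_mul]
              gcongr
              exact ContinuousMap.norm_coe_le_norm _ _
          _ = ∫ x, ‖trigPoly T G x‖ ∂haarAddCircle +
                ‖trigPoly T P‖ * ∫ x, ‖trigPoly T K x‖ ∂haarAddCircle := by
              rw [integral_add (Continuous.integrable_haarAddCircle (by fun_prop))
                (Continuous.integrable_haarAddCircle (by fun_prop)), integral_const_mul,
                integral_comp_nsmul_haarAddCircle hs0 (u := fun x => ‖trigPoly T K x‖)
                  (by fun_prop)]
          _ < η := by
              rw [lt_div_iff₀ (by positivity)] at hK
              have : 0 ≤ ∫ x, ‖trigPoly T K x‖ ∂haarAddCircle :=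
                integral_nonneg fun _ => norm_nonneg _
              nlinarith
      · refine le_of_eq_of_le (integral_congr_ae (Eventually.of_forall fun x => ?_)) hs.le
        have : 1 - trigPoly T (H + dilMul s P g) x =
            (1 - trigPoly T H x) * (1 - trigPoly T g (s • x)) := by
          rw [map_add, ContinuousMap.add_apply, trigPoly_dilMul, hPx]
          ring
        simp only [this]
        rw [norm_mul, Real.sqrt_mul (norm_nonneg _)]
  obtain ⟨n, hn⟩ := exists_pow_lt_of_lt_one hη (by norm_num : (1 - 1 / 24576 : ℝ) < 1)
  obtain ⟨G, H, h1, h2, h3⟩ := key n η hη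
  exact ⟨G, H, h1, h2, h3.trans_lt hn⟩

end

/-! ### Analytic polynomials without mean that are close to a constant -/

section

open AddCircle

variable {T : ℝ}

/-- A holomorphic function vanishing at `0` is uniformly approximated on each smaller circle by its
Taylor polynomials, which have only positive frequencies. -/
theorem exists_trigPoly_near_holomorphic {f : ℂ → ℂ}
    (hf : DifferentiableOn ℂ f (Metric.ball 0 1)) (hf0 : f 0 = 0) {r : ℝ} (hr0 : 0 ≤ r)
    (hr1 : r < 1) {ε : ℝ} (hε : 0 < ε) :
    ∃ h : ℤ →₀ ℂ, (∀ k, h k ≠ 0 → 0 < k) ∧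
      ∀ x, ‖trigPoly T h x - f (r * fourier 1 x)‖ < ε := by
  obtain ⟨r', hrr', hr'1⟩ := exists_between hr1
  obtain ⟨R, hr'R, hR1⟩ := exists_between hr'1
  lift r' to NNReal using by linarith
  lift R to NNReal using by linarith [r'.2]
  have hR0 : 0 < R := lt_of_le_of_lt (zero_le (a := r')) (by exact_mod_cast hr'R)
  have hfp := (hf.mono (Metric.closedBall_subset_ball hR1)).hasFPowerSeriesOnBall hR0
  set p := cauchyPowerSeries f 0 R
  have hu := hfp.tendstoUniformlyOn (r' := r') (by exact_mod_cast hr'R)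
  obtain ⟨N, hN⟩ := (Metric.tendstoUniformlyOn_iff.1 hu ε hε).exists
  have hp0 : p.coeff 0 = 0 := by
    have := hfp.coeff_zero (fun _ => 0)
    rw [FormalMultilinearSeries.apply_eq_pow_smul_coeff, hf0] at this
    simpa using this
  refine ⟨∑ k ∈ Finset.range N, Finsupp.single (k : ℤ) (r ^ k * p.coeff k), fun k hk => ?_,
    fun x => ?_⟩
  · rw [Finsupp.finsetSum_apply] at hk
    obtain ⟨l, -, hl⟩ := Finset.exists_ne_zero_of_sum_ne_zero hk
    rw [Finsupp.single_apply] at hl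
    rcases Nat.eq_zero_or_pos l with rfl | hl0
    · simp [hp0] at hl
    · by_contra hk0
      exact hl (if_neg (by omega))
  · have hz : (r : ℂ) * fourier 1 x ∈ Metric.ball (0 : ℂ) r' := by
      rw [mem_ball_zero_iff, norm_mul, norm_fourier_apply, Complex.norm_real, mul_one,
        Real.norm_of_nonneg hr0]
      exact hrr'
    have h := hN _ hz
    rw [zero_add, dist_comm, dist_eq_norm] at h
    refine lt_of_eq_of_lt (congrArg (fun w => ‖w - _‖) ?_) h
    rw [map_sum, ContinuousMap.coe_sum, Finset.sum_apply, FormalMultilinearSeries.partialSum]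
    refine Finset.sum_congr rfl fun k _ => ?_
    rw [FormalMultilinearSeries.apply_eq_pow_smul_coeff, trigPoly_single, mul_pow, smul_eq_mul]
    have : (fourier 1 x : ℂ) ^ k = fourier (k : ℤ) x := by
      rw [fourier_one, fourier_apply, natCast_zsmul, toCircle_nsmul, Circle.coe_pow]
    rw [this]
    ring

theorem re_div_one_sub_of_norm_eq_one {z : ℂ} (hz : ‖z‖ = 1) (hz1 : z ≠ 1) :
    (z / (1 - z)).re = -1 / 2 := by
  have h1 : z.re ^ 2 + z.im ^ 2 = 1 := by
    have := Complex.normSq_eq_norm_sq z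
    rw [hz, Complex.normSq_apply] at this
    linarith
  have h2 : 1 - z.re ≠ 0 := by
    intro h
    have h3 : z.im ^ 2 = 0 := by nlinarith
    exact hz1 (Complex.ext (by simp; linarith) (by simpa using h3))
  have h4 : Complex.normSq (1 - z) = 2 * (1 - z.re) := by
    rw [Complex.normSq_apply]
    simp
    linarith
  rw [Complex.div_re, h4]
  simp
  field_simp
  linarith

variable [hT : Fact (0 < T)]

theorem ae_fourier_one_ne_one : ∀ᵐ x : AddCircle T ∂haarAddCircle, (fourier 1 x : ℂ) ≠ 1 := by
  have hv : ∀ᵐ x : AddCircle T, (fourier 1 x : ℂ) ≠ 1 := by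
    have hsub : {x : AddCircle T | ¬ (fourier 1 x : ℂ) ≠ 1} ⊆ Metric.closedBall 0 0 := by
      intro x hx
      rw [Metric.closedBall_zero, Set.mem_singleton_iff]
      simp only [Set.mem_ofPred_eq, not_not, fourier_one] at hx
      refine injective_toCircle hT.out.ne' (Circle.ext ?_)
      rw [hx, toCircle_zero, Circle.coe_one]
    refine measure_mono_null hsub ?_
    rw [volume_closedBall]
    simp [hT.out.le]
  rw [volume_eq_smul_haarAddCircle, ae_iff, Measure.smul_apply, smul_eq_mul] at hv
  exact (mul_eq_zero.1 hv).resolve_left (by simpa using hT.out)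

/-- The approximations are `1 - exp (2A rz / (1 - rz))` with `z = e^{2πix/T}`. As `r → 1` the
real part of the exponent tends to `-A` at every point except `z = 1`, so that the exponential becomes
small, although its value at the centre of the disc is `1`. -/
theorem exists_pos_freq_near_one (T : ℝ) [Fact (0 < T)] {ε : ℝ} (hε : 0 < ε) :
    ∃ h : ℤ →₀ ℂ, (∀ k, h k ≠ 0 → 0 < k) ∧
      haarAddCircle {x | ε ≤ ‖trigPoly T h x - 1‖} < ENNReal.ofReal ε := by
  -- With this choice `exp (-A) = ε / 3`.
  set A : ℝ := -Real.log (ε / 3) with hA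
  set f : ℂ → ℂ := fun w => 1 - Complex.exp (2 * A * (w / (1 - w))) with hf
  have hfd : DifferentiableOn ℂ f (Metric.ball 0 1) := by
    intro w hw
    have : 1 - w ≠ 0 := by
      intro h
      rw [← sub_eq_zero.1 h] at hw
      simp at hw
    refine DifferentiableAt.differentiableWithinAt ?_
    simp only [hf]
    fun_prop (disch := assumption)
  set r : ℕ → ℝ := fun n => 1 - 1 / ((n : ℝ) + 1) with hr
  have hr1 : ∀ n, r n < 1 := fun n => by
    have : 0 < 1 / ((n : ℝ) + 1) := by positivity
    simp only [hr]
    linarith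
  have hr0 : ∀ n, 0 ≤ r n := fun n => by
    have : 1 / ((n : ℝ) + 1) ≤ 1 := by
      rw [div_le_one (by positivity)]
      linarith [n.cast_nonneg (α := ℝ)]
    simp only [hr]
    linarith
  have hrlim : Tendsto r atTop (𝓝 1) := by
    simpa [hr] using tendsto_one_div_add_atTop_nhds_zero_nat.const_sub (1 : ℝ)
  have hmem : ∀ n (x : AddCircle T), (r n : ℂ) * fourier 1 x ∈ Metric.ball (0 : ℂ) 1 := by
    intro n x
    rw [mem_ball_zero_iff, norm_mul, norm_fourier_apply, Complex.norm_real, mul_one,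
      Real.norm_of_nonneg (hr0 n)]
    exact hr1 n
  have hmeas : ∀ n, AEStronglyMeasurable (fun x : AddCircle T => f (r n * fourier 1 x))
      haarAddCircle := fun n =>
    (hfd.continuousOn.comp_continuous (by fun_prop) (hmem n)).aestronglyMeasurable
  have hlim : ∀ᵐ x : AddCircle T ∂haarAddCircle,
      Tendsto (fun n => f (r n * fourier 1 x)) atTop (𝓝 (f (fourier 1 x))) := by
    filter_upwards [ae_fourier_one_ne_one (T := T)] with x hx
    have hz : 1 - (fourier 1 x : ℂ) ≠ 0 := sub_ne_zero.2 (Ne.symm hx)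
    have hc : ContinuousAt f (fourier 1 x) := by
      simp only [hf]
      fun_prop (disch := assumption)
    refine hc.tendsto.comp ?_
    have := ((Complex.continuous_ofReal.tendsto 1).comp hrlim).mul_const (fourier 1 x : ℂ)
    simpa using this
  have hμ := tendstoInMeasure_of_tendsto_ae hmeas hlim (ENNReal.ofReal (ε / 3))
    (ENNReal.ofReal_pos.2 (by positivity))
  obtain ⟨n, hn⟩ := (hμ.eventually_lt_const (ENNReal.ofReal_pos.2 hε)).exists
  obtain ⟨h, hh, happ⟩ := exists_trigPoly_near_holomorphic (T := T) hfd (by simp [hf]) (hr0 n)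
    (hr1 n) (ε := ε / 3) (by positivity)
  refine ⟨h, hh, lt_of_le_of_lt (measure_mono_ae ?_) hn⟩
  filter_upwards [ae_fourier_one_ne_one (T := T)] with x hx hxε
  have hlimit : ‖f (fourier 1 x) - 1‖ = ε / 3 := by
    have : f (fourier 1 x) - 1 = -Complex.exp (2 * A * (fourier 1 x / (1 - fourier 1 x))) := by
      simp [hf]
    rw [this, norm_neg, Complex.norm_exp]
    have hre : (2 * (A : ℂ) * (fourier 1 x / (1 - fourier 1 x))).re = -A := by
      have h2 : (2 * (A : ℂ)) = ((2 * A : ℝ) : ℂ) := by push_cast; rfl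
      rw [h2, Complex.re_ofReal_mul,
        re_div_one_sub_of_norm_eq_one (norm_fourier_apply 1 x) hx]
      ring
    rw [hre, hA, neg_neg, Real.exp_log (by positivity)]
  change ENNReal.ofReal (ε / 3) ≤ edist _ _
  rw [edist_dist, dist_eq_norm]
  refine ENNReal.ofReal_le_ofReal ?_
  have hxε : ε ≤ ‖trigPoly T h x - 1‖ := hxε
  have h1 := happ x
  have h2 : trigPoly T h x - 1 = (trigPoly T h x - f (r n * fourier 1 x)) +
      (f (r n * fourier 1 x) - f (fourier 1 x)) + (f (fourier 1 x) - 1) := by ring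
  rw [h2] at hxε
  linarith [norm_add₃_le (a := trigPoly T h x - f (r n * fourier 1 x))
    (b := f (r n * fourier 1 x) - f (fourier 1 x)) (c := f (fourier 1 x) - 1)]

end

/-! ### Approximation off a small set by sign changes of a small polynomial -/

section

open AddCircle

/-- The polynomial `p(x) G(s₂ x) h(s₁ s₂ x)` combines the two preceding constructions: a change of signs
turns the small factor `G` into one close to `1`, while `h`, also close to `1`, pushes the spectrum
beyond any given bound. -/
theorem exists_signChange_near_trigPoly {T : ℝ} [Fact (0 < T)] (p : ℤ →₀ ℂ) (N : ℕ) {ε : ℝ}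
    (hε : 0 < ε) :
    ∃ a b : ℤ →₀ ℂ, SignChange a b ∧ (∀ k, a k ≠ 0 → (N : ℤ) < k) ∧
      ∫ x, ‖trigPoly T a x‖ ∂haarAddCircle < ε ∧
      haarAddCircle {x | ε ≤ ‖trigPoly T b x - trigPoly T p x‖} < ENNReal.ofReal ε := by
  set M := ‖trigPoly T p‖ + 1 with hM
  have hM1 : 1 ≤ M := by linarith [norm_nonneg (trigPoly T p)]
  have hpM : ∀ x, ‖trigPoly T p x‖ ≤ M := fun x =>
    (ContinuousMap.norm_coe_le_norm _ x).trans (by linarith)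
  set δ₁ := ε / (2 * M) with hδ₁
  have hδ₁0 : 0 < δ₁ := by positivity
  have hδ₁ε : δ₁ ≤ ε / 2 := div_le_div_of_nonneg_left hε.le (by positivity) (by linarith)
  obtain ⟨h, hpos, hh⟩ := exists_pos_freq_near_one T hδ₁0
  set L := ‖trigPoly T h‖ + 1 with hL
  have hL1 : 1 ≤ L := by linarith [norm_nonneg (trigPoly T h)]
  have hhL : ∀ x, ‖trigPoly T h x‖ ≤ L := fun x =>
    (ContinuousMap.norm_coe_le_norm _ x).trans (by linarith)
  set δ₂ := ε / (2 * M * L) with hδ₂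
  have hδ₂0 : 0 < δ₂ := by positivity
  obtain ⟨G, H, hGH, hG, hH⟩ := exists_signChange_integral_sqrt_lt T
    (η := min (ε / (M * L)) (√δ₂ * (ε / 2))) (by positivity)
  -- The bound for the mean of the square root gives a bound in measure by Markov's inequality.
  have hHμ : haarAddCircle {x | δ₂ ≤ ‖1 - trigPoly T H x‖} ≤ ENNReal.ofReal (ε / 2) := by
    have hmar := mul_meas_ge_le_integral_of_nonneg (μ := haarAddCircle (T := T))
      (f := fun x => √‖1 - trigPoly T H x‖) (Eventually.of_forall fun x => Real.sqrt_nonneg _)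
      (Continuous.integrable_haarAddCircle (by fun_prop)) (√δ₂)
    have hlt := hmar.trans_lt (hH.trans_le (min_le_right _ _))
    rw [mul_lt_mul_iff_of_pos_left (Real.sqrt_pos.2 hδ₂0)] at hlt
    rw [← ofReal_measureReal]
    refine ENNReal.ofReal_le_ofReal (le_trans (measureReal_mono fun x hx => ?_) hlt.le)
    exact Real.sqrt_le_sqrt hx
  obtain ⟨d, hd⟩ := exists_abs_le_of_ne_zero G
  obtain ⟨e, he⟩ := exists_abs_le_of_ne_zero p
  set s₁ := 2 * d + 1 with hs₁
  set s₂ := 2 * e + N + 1 with hs₂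
  have hs₁d : 2 * (d : ℤ) < (s₁ : ℕ) := by omega
  have hs₂e : 2 * (e : ℤ) < (s₂ : ℕ) := by omega
  have hs₁0 : s₁ ≠ 0 := by omega
  have hs₂0 : s₂ ≠ 0 := by omega
  refine ⟨dilMul s₂ p (dilMul s₁ G h), dilMul s₂ p (dilMul s₁ H h),
    (SignChange.refl p).dilMul (hGH.dilMul (SignChange.refl h) hd hs₁d) he hs₂e, fun m hm => ?_,
    ?_, ?_⟩
  · obtain ⟨k, j, hk, hj, rfl⟩ := exists_of_dilMul_ne_zero hm
    obtain ⟨k', j', hk', hj', rfl⟩ := exists_of_dilMul_ne_zero hj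
    have h1 := abs_le.1 (he k hk)
    have h2 := abs_le.1 (hd k' hk')
    have h3 := hpos j' hj'
    have h4 : 1 ≤ k' + (s₁ : ℤ) * j' := by nlinarith
    have h5 : (s₂ : ℤ) ≤ s₂ * (k' + (s₁ : ℤ) * j') := by nlinarith
    have h6 : (s₂ : ℤ) = 2 * e + N + 1 := by simp [hs₂]
    linarith
  · calc ∫ x, ‖trigPoly T (dilMul s₂ p (dilMul s₁ G h)) x‖ ∂haarAddCircle
        ≤ ∫ x, (M * L) * ‖trigPoly T G (s₂ • x)‖ ∂haarAddCircle := by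
          refine integral_mono (Continuous.integrable_haarAddCircle (by fun_prop))
            (Continuous.integrable_haarAddCircle (by fun_prop)) fun x => ?_
          simp only [trigPoly_dilMul, norm_mul]
          calc _ ≤ M * (‖trigPoly T G (s₂ • x)‖ * L) := by
                gcongr
                · exact hpM x
                · exact hhL _
            _ = _ := by ring
      _ = (M * L) * ∫ x, ‖trigPoly T G x‖ ∂haarAddCircle := by
          rw [integral_const_mul, integral_comp_nsmul_haarAddCircle hs₂0
            (u := fun x => ‖trigPoly T G x‖) (by fun_prop)]
      _ < (M * L) * (ε / (M * L)) := by
          gcongr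
          exact hG.trans_le (min_le_left _ _)
      _ = ε := by
          field_simp
  · set B : Set (AddCircle T) := {x | δ₂ ≤ ‖1 - trigPoly T H x‖} with hB
    set C : Set (AddCircle T) := {x | δ₁ ≤ ‖trigPoly T h x - 1‖} with hC
    have hBm : MeasurableSet B := (isClosed_le (by fun_prop) (by fun_prop)).measurableSet
    have hCm : MeasurableSet C := (isClosed_le (by fun_prop) (by fun_prop)).measurableSet
    have mp₁ := measurePreserving_nsmul_haarAddCircle (T := T) hs₁0
    have mp₂ := measurePreserving_nsmul_haarAddCircle (T := T) hs₂0
    have hsub : {x | ε ≤ ‖trigPoly T (dilMul s₂ p (dilMul s₁ H h)) x - trigPoly T p x‖} ⊆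
        (fun x : AddCircle T => s₂ • x) ⁻¹' (B ∪ (fun x : AddCircle T => s₁ • x) ⁻¹' C) := by
      intro x hx
      by_contra hcon
      simp only [Set.mem_preimage, Set.mem_union, not_or, hB, hC, Set.mem_ofPred_eq,
        not_le] at hcon hx
      obtain ⟨h1, h2⟩ := hcon
      set y := s₂ • x with hy
      have heq : trigPoly T (dilMul s₂ p (dilMul s₁ H h)) x - trigPoly T p x =
          trigPoly T p x * (-((1 - trigPoly T H y) * trigPoly T h (s₁ • y)) +
            (trigPoly T h (s₁ • y) - 1)) := by
        rw [trigPoly_dilMul, trigPoly_dilMul]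
        ring
      have hlt : ‖-((1 - trigPoly T H y) * trigPoly T h (s₁ • y)) +
          (trigPoly T h (s₁ • y) - 1)‖ < ε / M := by
        calc _ ≤ ‖1 - trigPoly T H y‖ * ‖trigPoly T h (s₁ • y)‖ +
              ‖trigPoly T h (s₁ • y) - 1‖ := by
              refine (norm_add_le _ _).trans ?_
              rw [norm_neg, norm_mul]
          _ ≤ δ₂ * L + ‖trigPoly T h (s₁ • y) - 1‖ := by
              gcongr
              exact hhL _
          _ < δ₂ * L + δ₁ := by
              gcongr
          _ = ε / M := by
              rw [hδ₁, hδ₂]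
              field_simp
              norm_num
      rw [heq, norm_mul] at hx
      have : ‖trigPoly T p x‖ * ‖-((1 - trigPoly T H y) * trigPoly T h (s₁ • y)) +
          (trigPoly T h (s₁ • y) - 1)‖ < ε := by
        calc _ ≤ M * ‖-((1 - trigPoly T H y) * trigPoly T h (s₁ • y)) +
              (trigPoly T h (s₁ • y) - 1)‖ := by
              gcongr
              exact hpM x
          _ < M * (ε / M) := by gcongr
          _ = ε := by field_simp
      linarith
    calc _ ≤ haarAddCircle ((fun x : AddCircle T => s₂ • x) ⁻¹'
          (B ∪ (fun x : AddCircle T => s₁ • x) ⁻¹' C)) := measure_mono hsub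
      _ = haarAddCircle (B ∪ (fun x : AddCircle T => s₁ • x) ⁻¹' C) :=
          mp₂.measure_preimage (hBm.union (mp₁.measurable hCm)).nullMeasurableSet
      _ ≤ haarAddCircle B + haarAddCircle ((fun x : AddCircle T => s₁ • x) ⁻¹' C) :=
          measure_union_le _ _
      _ = haarAddCircle B + haarAddCircle C := by
          rw [mp₁.measure_preimage hCm.nullMeasurableSet]
      _ < ENNReal.ofReal (ε / 2) + ENNReal.ofReal (ε / 2) := by
          refine ENNReal.add_lt_add_of_le_of_lt ?_ hHμ
            (hh.trans_le (ENNReal.ofReal_le_ofReal hδ₁ε))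
          exact measure_ne_top _ _
      _ = ENNReal.ofReal ε := by
          rw [← ENNReal.ofReal_add (by positivity) (by positivity), add_halves]

end

/-! ### Passage to the interval -/

section

open AddCircle Real

theorem fact_zero_lt_two_pi : Fact (0 < 2 * Real.pi) := ⟨Real.two_pi_pos⟩

attribute [local instance] fact_zero_lt_two_pi

theorem volumePi_eq_restrict_Ioc : volumePi = volume.restrict (Set.Ioc (-π) (-π + 2 * π)) := by
  have : -π + 2 * π = π := by ring
  rw [this, volumePi]
  exact Measure.restrict_congr_set Ioc_ae_eq_Icc.symm

instance isFiniteMeasure_volumePi : IsFiniteMeasure volumePi := by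
  unfold volumePi
  infer_instance

theorem measurePreserving_coe_volumePi :
    MeasurePreserving ((↑) : ℝ → AddCircle (2 * π)) volumePi
      (ENNReal.ofReal (2 * π) • haarAddCircle) := by
  rw [volumePi_eq_restrict_Ioc, ← volume_eq_smul_haarAddCircle]
  exact AddCircle.measurePreserving_mk (2 * π) (-π)

theorem integral_volumePi_comp_coe {u : AddCircle (2 * π) → ℝ} (hu : Continuous u) :
    ∫ x : ℝ, u x ∂volumePi = 2 * π * ∫ x, u x ∂haarAddCircle := by
  have h := measurePreserving_coe_volumePi
  have h1 : ∫ x : ℝ, u x ∂volumePi = ∫ y, u y ∂(ENNReal.ofReal (2 * π) • haarAddCircle) := by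
    rw [← h.map_eq]
    exact (integral_map h.aemeasurable hu.aestronglyMeasurable).symm
  rw [h1, integral_smul_measure, ENNReal.toReal_ofReal two_pi_pos.le, smul_eq_mul]

/-- The trigonometric polynomial `∑ a_k e^{ikx}` as a function on the line. -/
noncomputable def trigSum (a : ℤ →₀ ℂ) (x : ℝ) : ℂ := trigPoly (2 * π) a x

theorem trigSum_eq_sum_of_subset {a : ℤ →₀ ℂ} {s : Finset ℤ} (h : ∀ k, a k ≠ 0 → k ∈ s) (x : ℝ) :
    trigSum a x = ∑ k ∈ s, a k * Complex.exp (Complex.I * k * x) := by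
  rw [trigSum, trigPoly_eq_sum_of_subset h]
  refine Finset.sum_congr rfl fun k _ => ?_
  rw [fourier_coe_apply]
  have hpi : (π : ℂ) ≠ 0 := by exact_mod_cast pi_ne_zero
  congr 2
  push_cast
  field_simp

theorem trigSum_add (a b : ℤ →₀ ℂ) (x : ℝ) : trigSum (a + b) x = trigSum a x + trigSum b x := by
  simp [trigSum]

@[fun_prop]
theorem continuous_trigSum (a : ℤ →₀ ℂ) : Continuous (trigSum a) :=
  (trigPoly (2 * π) a).continuous.comp (AddCircle.continuous_mk' _)

theorem integrable_trigSum (a : ℤ →₀ ℂ) : Integrable (trigSum a) volumePi :=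
  (continuous_trigSum a).continuousOn.integrableOn_compact isCompact_Icc

theorem exists_integral_sub_trigSum_lt {f : ℝ → ℂ} (hf : Integrable f volumePi) {ε : ℝ}
    (hε : 0 < ε) : ∃ p, ∫ x, ‖trigSum p x - f x‖ ∂volumePi < ε := by
  set F := liftIoc (2 * π) (-π) f with hF
  have hfI : Integrable f (volume.restrict (Set.Ioc (-π) (-π + 2 * π))) := by
    rwa [← volumePi_eq_restrict_Ioc]
  have hFI : Integrable F (volume : Measure (AddCircle (2 * π))) :=
    memLp_one_iff_integrable.1 (memLp_one_iff_integrable.2 hfI).memLp_liftIoc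
  obtain ⟨g, hg, -⟩ := hFI.exists_boundedContinuous_integral_sub_le (ε := ε / 2) (by positivity)
  obtain ⟨p, hp⟩ := exists_norm_trigPoly_sub_lt g.toContinuousMap
    (ε := ε / 4 / (2 * π)) (by positivity)
  refine ⟨p, ?_⟩
  have hpI : Integrable (fun x => trigPoly (2 * π) p x) (volume : Measure (AddCircle (2 * π))) :=
    (map_continuous _).integrable_of_hasCompactSupport (HasCompactSupport.of_compactSpace _)
  have hgI : Integrable g (volume : Measure (AddCircle (2 * π))) :=
    (map_continuous _).integrable_of_hasCompactSupport (HasCompactSupport.of_compactSpace _)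
  have hFg : Integrable (fun y => ‖F y - g y‖) := (hFI.sub hgI).norm
  have h1 : ∫ x, ‖trigSum p x - f x‖ ∂volumePi =
      ∫ y, ‖trigPoly (2 * π) p y - F y‖ := by
    rw [← AddCircle.integral_preimage (2 * π) (-π), volumePi_eq_restrict_Ioc]
    refine setIntegral_congr_fun measurableSet_Ioc fun x hx => ?_
    simp only [trigSum, hF, liftIoc_coe_apply hx]
  rw [h1]
  calc ∫ y, ‖trigPoly (2 * π) p y - F y‖
      ≤ ∫ y : AddCircle (2 * π), (ε / 4 / (2 * π) + ‖F y - g y‖) := by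
        refine integral_mono (hpI.sub hFI).norm ((integrable_const _).add hFg)
          fun y => ?_
        have h2 : ‖trigPoly (2 * π) p y - g y‖ ≤ ε / 4 / (2 * π) :=
          (ContinuousMap.norm_coe_le_norm (trigPoly (2 * π) p - g.toContinuousMap) y).trans hp.le
        rw [norm_sub_rev (F y)]
        exact (norm_sub_le_norm_sub_add_norm_sub _ _ _).trans (by gcongr)
    _ = ε / 4 + ∫ y, ‖F y - g y‖ := by
        rw [integral_add (integrable_const _) hFg, integral_const, measureReal_def,
          AddCircle.measure_univ, ENNReal.toReal_ofReal two_pi_pos.le, smul_eq_mul]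
        field_simp
    _ < ε := by linarith

/-- Every integrable function can be approximated, off a set of small measure, by changing signs of the
coefficients of an `L¹`-small polynomial with arbitrarily large frequencies. -/
theorem exists_signChange_near {f : ℝ → ℂ} (hf : Integrable f volumePi) (N : ℕ) {ε : ℝ}
    (hε : 0 < ε) :
    ∃ a b : ℤ →₀ ℂ, SignChange a b ∧ (∀ k, a k ≠ 0 → (N : ℤ) < k) ∧
      ∫ x, ‖trigSum a x‖ ∂volumePi < ε ∧
      ∃ E, MeasurableSet E ∧ volumePi Eᶜ < ENNReal.ofReal ε ∧
        ∫ x in E, ‖trigSum b x - f x‖ ∂volumePi < ε := by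
  obtain ⟨p, hp⟩ := exists_integral_sub_trigSum_lt hf (ε := ε / 2) (by positivity)
  obtain ⟨a, b, hab, haN, ha, hb⟩ := exists_signChange_near_trigPoly (T := 2 * π) p N
    (ε := ε / 2 / (2 * π)) (by positivity)
  set ε' := ε / 2 / (2 * π) with hε'
  have hε'0 : 0 < ε' := by positivity
  have hεε' : 2 * π * ε' = ε / 2 := by
    rw [hε']
    field_simp
  set B : Set (AddCircle (2 * π)) :=
    {x | ε' ≤ ‖trigPoly (2 * π) b x - trigPoly (2 * π) p x‖} with hB
  have hBm : MeasurableSet B := (isClosed_le (by fun_prop) (by fun_prop)).measurableSet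
  have hcm := measurePreserving_coe_volumePi
  refine ⟨a, b, hab, haN, ?_, (((↑) : ℝ → AddCircle (2 * π)) ⁻¹' B)ᶜ,
    (hcm.measurable hBm).compl, ?_, ?_⟩
  · simp only [trigSum]
    rw [integral_volumePi_comp_coe (u := fun x => ‖trigPoly (2 * π) a x‖) (by fun_prop)]
    nlinarith [two_pi_pos]
  · rw [compl_compl, hcm.measure_preimage hBm.nullMeasurableSet, Measure.smul_apply, smul_eq_mul]
    calc _ < ENNReal.ofReal (2 * π) * ENNReal.ofReal ε' :=
          ENNReal.mul_lt_mul_right (by simpa using pi_pos) ENNReal.ofReal_ne_top hb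
      _ = ENNReal.ofReal (ε / 2) := by
          rw [← ENNReal.ofReal_mul two_pi_pos.le, hεε']
      _ ≤ ENNReal.ofReal ε := ENNReal.ofReal_le_ofReal (by linarith)
  · set E : Set ℝ := (((↑) : ℝ → AddCircle (2 * π)) ⁻¹' B)ᶜ with hE
    have hEm : MeasurableSet E := (hcm.measurable hBm).compl
    have hi : ∀ c, Integrable (fun x => ‖trigSum c x - f x‖) volumePi := fun c =>
      ((integrable_trigSum c).sub hf).norm
    calc ∫ x in E, ‖trigSum b x - f x‖ ∂volumePi
        ≤ ∫ x in E, (ε' + ‖trigSum p x - f x‖) ∂volumePi := by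
          refine setIntegral_mono_on (hi b).integrableOn
            ((integrable_const _).add (hi p)).integrableOn hEm fun x hx => ?_
          have h2 : ‖trigSum b x - trigSum p x‖ < ε' := not_le.1 hx
          exact (norm_sub_le_norm_sub_add_norm_sub _ _ _).trans (by gcongr)
      _ ≤ ∫ x, (ε' + ‖trigSum p x - f x‖) ∂volumePi :=
          setIntegral_le_integral ((integrable_const _).add (hi p))
            (Eventually.of_forall fun x => by positivity)
      _ = 2 * π * ε' + ∫ x, ‖trigSum p x - f x‖ ∂volumePi := by
          rw [integral_add (integrable_const _) (hi p), integral_const]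
          congr 1
          rw [volumePi, measureReal_restrict_apply_univ, Real.volume_real_Icc_of_le
            (by linarith [pi_pos]), smul_eq_mul]
          ring
      _ < ε := by linarith

end

/-! ### Universal series -/

/-- The `L¹`-sum of a series of functions whose norms are summable. -/
theorem exists_integrable_ae_eq_tsum {α : Type*} [MeasurableSpace α] {μ : Measure α}
    {F : ℕ → α → ℂ} (hF : ∀ k, Integrable (F k) μ) (hs : Summable fun k => ∫ x, ‖F k x‖ ∂μ) :
    ∃ U : α → ℂ, Integrable U μ ∧ U =ᵐ[μ] fun x => ∑' k, F k x := by
  have hne : ∑' k, ‖(hF k).toL1 (F k)‖ₑ ≠ ⊤ := by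
    have h1 : ∀ k, ‖(hF k).toL1 (F k)‖ₑ = ENNReal.ofReal (∫ x, ‖F k x‖ ∂μ) := fun k => by
      rw [← ofReal_norm, L1.norm_of_fun_eq_integral_norm]
    simp_rw [h1]
    exact hs.tsum_ofReal_ne_top
  refine ⟨(∑' k, (hF k).toL1 (F k) : Lp ℂ 1 μ), L1.integrable_coeFn _, ?_⟩
  filter_upwards [Lp.coeFn_tsum hne, ae_all_iff.2 fun k => (hF k).coeFn_toL1] with x hx hx'
  rw [hx]
  exact tsum_congr hx'

/-- A sequence that visits each member of a countable dense set infinitely often. -/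
theorem exists_frequently_integral_sub_lt : ∃ t : ℕ → ℝ → ℂ, (∀ k, Integrable (t k) volumePi) ∧
    ∀ f : ℝ → ℂ, Integrable f volumePi → ∀ ε > 0,
      ∃ᶠ k in atTop, ∫ x, ‖t k x - f x‖ ∂volumePi < ε := by
  unfold volumePi
  set μ : Measure ℝ := volume.restrict (Set.Icc (-Real.pi) Real.pi)
  have : Fact ((1 : ENNReal) ≠ ⊤) := ⟨ENNReal.one_ne_top⟩
  refine ⟨fun k => TopologicalSpace.denseSeq (Lp ℂ 1 μ) k.unpair.1,
    fun k => L1.integrable_coeFn _, fun f hf ε hε => ?_⟩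
  obtain ⟨_, ⟨i, rfl⟩, hi⟩ := Metric.mem_closure_iff.1
    (TopologicalSpace.denseRange_denseSeq (Lp ℂ 1 μ) (hf.toL1 f)) ε hε
  refine frequently_atTop.2 fun k => ⟨Nat.pair i k, Nat.right_le_pair i k, ?_⟩
  rw [dist_comm, dist_eq_norm, L1.norm_eq_integral_norm] at hi
  simp only [Nat.unpair_pair]
  refine lt_of_eq_of_lt (integral_congr_ae ?_) hi
  filter_upwards [Lp.coeFn_sub (TopologicalSpace.denseSeq (Lp ℂ 1 μ) i) (hf.toL1 f),
    hf.coeFn_toL1] with x h1 h2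
  rw [h1, Pi.sub_apply, h2]

theorem coeff_trigSum (a : ℤ →₀ ℂ) (n : ℤ) : trigSystem.coeff n (trigSum a) = a n := by
  have h : ∀ x, trigSum a x * trigSystem.ψ n x =
      ∑ k ∈ a.support, a k * (trigSystem.φ k x * trigSystem.ψ n x) := by
    intro x
    rw [trigSum_eq_sum_of_subset (fun k hk => Finsupp.mem_support_iff.2 hk), Finset.sum_mul]
    exact Finset.sum_congr rfl fun k _ => mul_assoc _ _ _
  have hi : ∀ k, Integrable (fun x => trigSystem.φ k x * trigSystem.ψ n x) volumePi := fun k =>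
    (trigSystem.integrable_φ k).mul_of_top_left (trigSystem.memLp_ψ n)
  rw [BiorthogonalSystem.coeff]
  simp_rw [h]
  rw [integral_finsetSum _ fun k _ => (hi k).const_mul _]
  simp_rw [integral_const_mul, trigSystem.biorthogonal]
  simp [eq_comm]

/-- Successive blocks of frequencies: the sign-changed polynomial of the `k`-th block corrects the sum
of the preceding ones so that the new sum is close to the `k`-th target. -/
theorem exists_blocks {t : ℕ → ℝ → ℂ} (ht : ∀ k, Integrable (t k) volumePi) :
    ∃ (a b : ℕ → ℤ →₀ ℂ) (N : ℕ → ℕ) (E : ℕ → Set ℝ),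
      (∀ k, SignChange (a k) (b k)) ∧ StrictMono N ∧
      (∀ k n, a k n ≠ 0 → (N k : ℤ) < n ∧ n ≤ N (k + 1)) ∧
      (∀ k, ∫ x, ‖trigSum (a k) x‖ ∂volumePi < (1 / 2) ^ k) ∧
      (∀ k, MeasurableSet (E k)) ∧
      (∀ k, volumePi (E k)ᶜ < ENNReal.ofReal ((1 / 2) ^ k)) ∧
      ∀ k, ∫ x in E k, ‖trigSum (∑ j ∈ Finset.range (k + 1), b j) x - t k x‖ ∂volumePi
        < (1 / 2) ^ k := by
  have step : ∀ (k : ℕ) (s : (ℤ →₀ ℂ) × ℕ), ∃ (a b : ℤ →₀ ℂ) (N : ℕ) (E : Set ℝ),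
      SignChange a b ∧ s.2 < N ∧ (∀ n, a n ≠ 0 → (s.2 : ℤ) < n ∧ n ≤ N) ∧
      ∫ x, ‖trigSum a x‖ ∂volumePi < (1 / 2) ^ k ∧ MeasurableSet E ∧
      volumePi Eᶜ < ENNReal.ofReal ((1 / 2) ^ k) ∧
      ∫ x in E, ‖trigSum (s.1 + b) x - t k x‖ ∂volumePi < (1 / 2) ^ k := by
    intro k s
    obtain ⟨a, b, hab, haN, ha, E, hE, hEμ, hEi⟩ := exists_signChange_near
      ((ht k).sub (integrable_trigSum s.1)) s.2 (ε := (1 / 2) ^ k) (by positivity)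
    obtain ⟨d, hd⟩ := exists_abs_le_of_ne_zero a
    refine ⟨a, b, max (s.2 + 1) d, E, hab, by simp, fun n hn => ⟨haN n hn, ?_⟩, ha, hE, hEμ, ?_⟩
    · exact (le_abs_self n).trans ((hd n hn).trans (by exact_mod_cast le_max_right _ _))
    · convert hEi using 4 with x
      rw [trigSum_add, Pi.sub_apply]
      ring
  choose a b N E hab hN haN ha hE hEμ hEi using step
  let st : ℕ → (ℤ →₀ ℂ) × ℕ := fun k => Nat.rec (0, 0) (fun k s => (s.1 + b k s, N k s)) k
  have hst : ∀ k, (st k).1 = ∑ j ∈ Finset.range k, b j (st j) := by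
    intro k
    induction k with
    | zero => rfl
    | succ k ih =>
      rw [Finset.sum_range_succ, ← ih]
  refine ⟨fun k => a k (st k), fun k => b k (st k), fun k => (st k).2, fun k => E k (st k),
    fun k => hab _ _, strictMono_nat_of_lt_succ fun k => hN k (st k), fun k => haN k (st k),
    fun k => ha _ _, fun k => hE _ _, fun k => hEμ _ _, fun k => ?_⟩
  rw [Finset.sum_range_succ, ← hst]
  exact hEi k (st k)

/-- The universal function has only positive frequencies, so that one and the same function serves for
both systems. -/
theorem exists_universal_pos_freq : ∃ (U : ℝ → ℂ) (δ : ℤ → ℂ) (F : ℕ → Set ℝ),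
    Integrable U volumePi ∧ (∀ n ≤ 0, trigSystem.coeff n U = 0) ∧
    (∀ n, δ n ∈ ({1, -1} : Set ℂ)) ∧ (∀ m, MeasurableSet (F m)) ∧ Monotone F ∧
    Tendsto (fun m => volumePi (F m)ᶜ) atTop (𝓝 0) ∧
    ∀ f : ℝ → ℂ, Integrable f volumePi → ∃ N : ℕ → ℕ, StrictMono N ∧
      ∀ m, Tendsto (fun q => ∫ x in F m,
        ‖(∑ n ∈ Finset.Ioc 0 (N q : ℤ), δ n * trigSystem.coeff n U * trigSystem.φ n x) - f x‖
          ∂volumePi) atTop (𝓝 0) := by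
  classical
  obtain ⟨t, ht, hdense⟩ := exists_frequently_integral_sub_lt
  obtain ⟨a, b, N, E, hab, hN, haN, ha, hE, hEμ, hEi⟩ := exists_blocks ht
  have hsum : Summable fun k => ∫ x, ‖trigSum (a k) x‖ ∂volumePi :=
    Summable.of_nonneg_of_le (fun k => integral_nonneg fun _ => norm_nonneg _)
      (fun k => (ha k).le) summable_geometric_two
  obtain ⟨U, hU, hUsum⟩ := exists_integrable_ae_eq_tsum (fun k => integrable_trigSum (a k)) hsum
  -- At most one block contains a given frequency.
  have hdisj : ∀ {i j : ℕ} {n : ℤ}, a i n ≠ 0 → a j n ≠ 0 → i = j := by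
    have hlt : ∀ {i j : ℕ} {n : ℤ}, i < j → a i n ≠ 0 → a j n = 0 := by
      intro i j n hij hi
      by_contra hj
      have h1 := (haN i n hi).2
      have h2 := (haN j n hj).1
      have h3 : (N (i + 1) : ℤ) ≤ N j := by exact_mod_cast hN.monotone hij
      linarith
    intro i j n hi hj
    rcases lt_trichotomy i j with h | h | h
    · exact absurd (hlt h hi) hj
    · exact h
    · exact absurd (hlt h hj) hi
  have hcoeff : ∀ n, trigSystem.coeff n U = ∑' j, a j n := by
    intro n
    have hmem := trigSystem.memLp_ψ n
    have hψ : ∀ x, ‖trigSystem.ψ n x‖ = ‖(2 * Real.pi : ℂ)⁻¹‖ := by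
      intro x
      simp only [trigSystem]
      rw [norm_mul, Complex.norm_exp]
      simp
    have hi : ∀ j, Integrable (fun x => trigSum (a j) x * trigSystem.ψ n x) volumePi := fun j =>
      (integrable_trigSum (a j)).mul_of_top_left hmem
    have hs : Summable fun j => ∫ x, ‖trigSum (a j) x * trigSystem.ψ n x‖ ∂volumePi := by
      simp_rw [norm_mul, hψ, integral_mul_const]
      exact hsum.mul_right _
    calc trigSystem.coeff n U
        = ∫ x, ∑' j, trigSum (a j) x * trigSystem.ψ n x ∂volumePi := by
          refine integral_congr_ae ?_
          filter_upwards [hUsum] with x hx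
          rw [hx, tsum_mul_right]
      _ = ∑' j, ∫ x, trigSum (a j) x * trigSystem.ψ n x ∂volumePi :=
          (integral_tsum_of_summable_integral_norm hi hs).symm
      _ = ∑' j, a j n := tsum_congr fun j => coeff_trigSum (a j) n
  set δ : ℤ → ℂ := fun n => if ∃ j, b j n ≠ a j n then -1 else 1 with hδ
  have hδb : ∀ j n, b j n = δ n * a j n := by
    intro j n
    by_cases h0 : a j n = 0
    · rw [h0, mul_zero, (hab j).eq_zero_iff, h0]
    by_cases hba : b j n = a j n
    · have : ¬ ∃ j, b j n ≠ a j n := by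
        rintro ⟨i, hi⟩
        by_cases hi0 : a i n = 0
        · exact hi (by rw [hi0, (hab i).eq_zero_iff, hi0])
        · exact hi (hdisj hi0 h0 ▸ hba)
      rw [hδ]
      simp only [if_neg this]
      rw [hba, one_mul]
    · rw [hδ]
      simp only [if_pos (show ∃ j, b j n ≠ a j n from ⟨j, hba⟩)]
      rw [((hab j) n).resolve_left hba, neg_one_mul]
  have hbN : ∀ k n, b k n ≠ 0 → (N k : ℤ) < n ∧ n ≤ N (k + 1) := fun k n hk =>
    haN k n fun h => hk (((hab k).eq_zero_iff n).2 h)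
  have hpartial : ∀ k x, ∑ n ∈ Finset.Ioc 0 (N k : ℤ),
      δ n * trigSystem.coeff n U * trigSystem.φ n x =
      trigSum (∑ j ∈ Finset.range k, b j) x := by
    intro k x
    rw [trigSum_eq_sum_of_subset (s := Finset.Ioc 0 (N k : ℤ))]
    · refine Finset.sum_congr rfl fun n hn => ?_
      have h1 : δ n * trigSystem.coeff n U = (∑ j ∈ Finset.range k, b j) n := by
        rw [hcoeff, ← tsum_mul_left, Finsupp.finsetSum_apply]
        simp_rw [← hδb]
        refine tsum_eq_sum fun j hj => ?_
        by_contra hne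
        have h2 := (hbN j n hne).1
        have h3 : (N k : ℤ) ≤ N j := by
          exact_mod_cast hN.monotone (not_lt.1 fun h => hj (Finset.mem_range.2 h))
        linarith [(Finset.mem_Ioc.1 hn).2]
      rw [h1]
      rfl
    · intro n hn
      rw [Finsupp.finsetSum_apply] at hn
      obtain ⟨j, hj, hjn⟩ := Finset.exists_ne_zero_of_sum_ne_zero hn
      have h2 := hbN j n hjn
      have h3 : (N (j + 1) : ℤ) ≤ N k := by exact_mod_cast hN.monotone (Finset.mem_range.1 hj)
      rw [Finset.mem_Ioc]
      omega
  refine ⟨U, δ, fun m => ⋂ k, E (k + m), hU, fun n hn => ?_, fun n => ?_,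
    fun m => MeasurableSet.iInter fun k => hE _, ?_, ?_, fun f hf => ?_⟩
  · rw [hcoeff]
    refine (tsum_congr fun j => ?_).trans tsum_zero
    by_contra hne
    have := (haN j n hne).1
    omega
  · simp only [hδ]
    split_ifs <;> simp
  · intro m m' hmm' x hx
    simp only [Set.mem_iInter] at hx ⊢
    intro k
    have := hx (k + (m' - m))
    rwa [add_assoc, Nat.sub_add_cancel hmm'] at this
  · have hfin : ∑' k, volumePi (E k)ᶜ ≠ ⊤ :=
      ne_top_of_le_ne_top summable_geometric_two.tsum_ofReal_ne_top
        (ENNReal.tsum_le_tsum fun k => (hEμ k).le)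
    refine tendsto_of_tendsto_of_tendsto_of_le_of_le tendsto_const_nhds
      (ENNReal.tendsto_sum_nat_add _ hfin) (fun m => zero_le) fun m => ?_
    simp only [Set.compl_iInter]
    exact measure_iUnion_le _
  · obtain ⟨ψ, hψ, hψf⟩ := extraction_forall_of_frequently
      (P := fun q k => ∫ x, ‖t k x - f x‖ ∂volumePi < 1 / ((q : ℝ) + 1))
      fun q => hdense f hf _ (by positivity)
    refine ⟨fun q => N (ψ q + 1), fun i j hij => hN (by have := hψ hij; omega), fun m => ?_⟩
    simp_rw [hpartial]
    have hlim : Tendsto (fun q : ℕ => (1 / 2 : ℝ) ^ ψ q + 1 / ((q : ℝ) + 1)) atTop (𝓝 0) := by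
      have h1 := (tendsto_pow_atTop_nhds_zero_of_lt_one (r := (1 / 2 : ℝ)) (by norm_num)
        (by norm_num)).comp hψ.tendsto_atTop
      simpa using h1.add (tendsto_one_div_add_atTop_nhds_zero_nat (𝕜 := ℝ))
    refine squeeze_zero' (Eventually.of_forall fun q => integral_nonneg fun _ => norm_nonneg _)
      ?_ hlim
    filter_upwards [eventually_ge_atTop m] with q hq
    have hsub : (⋂ k, E (k + m)) ⊆ E (ψ q) := by
      have h := Set.iInter_subset (fun k => E (k + m)) (ψ q - m)
      rwa [Nat.sub_add_cancel (hq.trans hψ.le_apply)] at h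
    set S := trigSum (∑ j ∈ Finset.range (ψ q + 1), b j) with hS
    have hSi : Integrable S volumePi := integrable_trigSum _
    have hSt : Integrable (fun x => ‖S x - t (ψ q) x‖) volumePi := (hSi.sub (ht _)).norm
    have htf : Integrable (fun x => ‖t (ψ q) x - f x‖) volumePi := ((ht _).sub hf).norm
    have hSf : Integrable (fun x => ‖S x - f x‖) volumePi := (hSi.sub hf).norm
    calc ∫ x in ⋂ k, E (k + m), ‖S x - f x‖ ∂volumePi
        ≤ ∫ x in E (ψ q), ‖S x - f x‖ ∂volumePi :=
          setIntegral_mono_set hSf.integrableOn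
            (Eventually.of_forall fun _ => norm_nonneg _) hsub.eventuallyLE
      _ ≤ ∫ x in E (ψ q), (‖S x - t (ψ q) x‖ + ‖t (ψ q) x - f x‖) ∂volumePi :=
          integral_mono hSf.integrableOn (hSt.add htf).integrableOn fun x =>
            norm_sub_le_norm_sub_add_norm_sub _ _ _
      _ = ∫ x in E (ψ q), ‖S x - t (ψ q) x‖ ∂volumePi +
            ∫ x in E (ψ q), ‖t (ψ q) x - f x‖ ∂volumePi :=
          integral_add hSt.integrableOn htf.integrableOn
      _ ≤ (1 / 2) ^ ψ q + 1 / ((q : ℝ) + 1) :=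
          add_le_add (hEi _).le ((setIntegral_le_integral htf
            (Eventually.of_forall fun _ => norm_nonneg _)).trans (hψf q).le)

theorem corollary2 :
    (∃ U : ℝ → ℂ, Integrable U volumePi ∧
      trigSystem.IsAsymptoticallyConditionallyUniversal
        (fun N : ℕ => Finset.Icc (-(N : ℤ)) (N : ℤ)) {1, -1} U) ∧
    (∃ U : ℝ → ℂ, Integrable U volumePi ∧
      trigSequence.IsAsymptoticallyConditionallyUniversal
        (fun N : ℕ => Finset.range N) {1, -1} U) := by
  obtain ⟨U, δ, F, hU, hU0, hδ, hF, hFm, hFμ, hconv⟩ := exists_universal_pos_freq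
  refine ⟨⟨U, hU, δ, F, hδ, hF, hFm, hFμ, fun f hf => ?_⟩,
    ⟨U, hU, fun n => δ (n + 1), F, fun n => hδ _, hF, hFm, hFμ, fun f hf => ?_⟩⟩
  · obtain ⟨N, hN, hlim⟩ := hconv f hf
    refine ⟨N, hN, fun m => (hlim m).congr fun q => ?_⟩
    congr 1
    ext x
    congr 2
    refine Finset.sum_subset (fun n hn => ?_) fun n _ hn' => ?_
    · rw [Finset.mem_Ioc] at hn
      rw [Finset.mem_Icc]
      omega
    · rename_i hn
      rw [Finset.mem_Icc] at hn
      rw [Finset.mem_Ioc] at hn'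
      rw [hU0 n (by omega), mul_zero, zero_mul]
  · obtain ⟨N, hN, hlim⟩ := hconv f hf
    refine ⟨N, hN, fun m => (hlim m).congr fun q => ?_⟩
    congr 1
    ext x
    congr 2
    symm
    refine Finset.sum_nbij (fun k : ℕ => (k : ℤ) + 1) (fun k hk => ?_) (fun k _ l _ h => ?_)
      (fun n hn => ?_) fun k _ => rfl
    · rw [Finset.mem_range] at hk
      rw [Finset.mem_Ioc]
      omega
    · simpa using h
    · rw [Finset.mem_coe, Finset.mem_Ioc] at hn
      refine ⟨(n - 1).toNat, ?_, ?_⟩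
      · rw [Finset.mem_coe, Finset.mem_range]
        omega
      · simp only
        omega
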